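/- Let $\mathrm{Sp}_4(\mathbb{Z})$ be the group of $4\times 4$ integer matrices $M$ with $M^{T}JM=J$, where $J=\begin{pmatrix}0&I_2\\-I_2&0\end{pmatrix}$. Then $\mathrm{Sp}_4(\mathbb{Z})$ has a presentation with five generators $\sigma_1,\dots,\sigma_5$ and the following twelve relations: the ten braid relations $$\sigma_i\sigma_j=\sigma_j\sigma_i\quad(1\le i,j\le 5,\ |i-j|\ge 2),\qquad \sigma_i\sigma_{i+1}\sigma_i=\sigma_{i+1}\sigma_i\sigma_{i+1}\quad(1\le i\le 4)$$ (the pairs $(i,j)$ and $(j,i)$ giving the same relation), together with $$(\sigma_1\sigma_2\sigma_1)^2(\sigma_1\sigma_3^{-1}\sigma_5)(\sigma_1\sigma_2\sigma_1)^{-2}=(\sigma_1\sigma_3^{-1}\sigma_5)^{-1}\qquad\text{and}\qquad(\sigma_1\sigma_2\sigma_1)^4=1.$$ More precisely, there is an isomorphism from the group with this presentation onto $\mathrm{Sp}_4(\mathbb{Z})$ such that, writing $U(B)=\begin{pmatrix}I_2&B\\0&I_2\end{pmatrix}$ and $L(C)=\begin{pmatrix}I_2&0\\C&I_2\end{pmatrix}$,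 $$\sigma_1\mapsto U\begin{pmatrix}1&0\\0&0\end{pmatrix},\quad \sigma_2\mapsto L\begin{pmatrix}-1&0\\0&0\end{pmatrix},\quad \sigma_3\mapsto U\begin{pmatrix}1&-1\\-1&1\end{pmatrix},\quad \sigma_4\mapsto L\begin{pmatrix}0&0\\0&-1\end{pmatrix},\quad \sigma_5\mapsto U\begin{pmatrix}0&0\\0&1\end{pmatrix}.$$ -/

import Mathlib

/-- The free generators `σ₁, …, σ₅`; the index set `Fin 5` starts at `0`, so `σᵢ` has index
`i - 1`. -/
def sigma1 : FreeGroup (Fin 5) := FreeGroup.of 0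
/-- The free generator `σ₂`. -/
def sigma2 : FreeGroup (Fin 5) := FreeGroup.of 1
/-- The free generator `σ₃`. -/
def sigma3 : FreeGroup (Fin 5) := FreeGroup.of 2
/-- The free generator `σ₄`. -/
def sigma4 : FreeGroup (Fin 5) := FreeGroup.of 3
/-- The free generator `σ₅`. -/
def sigma5 : FreeGroup (Fin 5) := FreeGroup.of 4

/-- The twelve defining relations, each written as a pair (left-hand side, right-hand side):
the six commutation relations and the four braid relations of the braid group on six strands,
followed by the two additional relations. -/
def sp4Relations : List (FreeGroup (Fin 5) × FreeGroup (Fin 5)) :=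
  [(sigma1 * sigma3, sigma3 * sigma1),
   (sigma1 * sigma4, sigma4 * sigma1),
   (sigma1 * sigma5, sigma5 * sigma1),
   (sigma2 * sigma4, sigma4 * sigma2),
   (sigma2 * sigma5, sigma5 * sigma2),
   (sigma3 * sigma5, sigma5 * sigma3),
   (sigma1 * sigma2 * sigma1, sigma2 * sigma1 * sigma2),
   (sigma2 * sigma3 * sigma2, sigma3 * sigma2 * sigma3),
   (sigma3 * sigma4 * sigma3, sigma4 * sigma3 * sigma4),
   (sigma4 * sigma5 * sigma4, sigma5 * sigma4 * sigma5),
   ((sigma1 * sigma2 * sigma1) ^ 2 * (sigma1 * sigma3⁻¹ * sigma5) *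
      ((sigma1 * sigma2 * sigma1) ^ 2)⁻¹,
    (sigma1 * sigma3⁻¹ * sigma5)⁻¹),
   ((sigma1 * sigma2 * sigma1) ^ 4, 1)]

/-- The relators `l * r⁻¹` attached to the twelve relations `l = r`. -/
def sp4Relators : Set (FreeGroup (Fin 5)) :=
  {w | ∃ p ∈ sp4Relations, w = p.1 * p.2⁻¹}

/-! Let `Γ` be generated by five elements satisfying the relations, with a map `φ` to the symplectic
group sending them to the displayed matrices. The point is that `φ` is injective; the argument lets
`Γ` act on `ℤ⁴` and determines the stabiliser of the first basis vector inside `Γ` itself, not just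
inside the matrix group.

The relations first yield commutator formulas for root elements. The half-twist reverses the
generators, so every identity has a mirror image. The key formula is `s2_inv_z`; conjugation by the
quarter turns `w1` and `w2` leads from it to the remaining ones and to the braid relation `wL_eq`
between `y` and `y'⁻¹`. Since `SL₂(ℤ)` is presented by a braid relation and a fourth power
(`exists_hom_SL2Z`), `Γ` receives three homomorphisms `psi1`, `psi2`, `psiL` from `SL₂(ℤ)`. They
serve to build a Siegel subgroup and a subgroup `klingen` fixing the first basis vector, both with
explicit normal forms.

The set `cell` is a product of these pieces. Elements of `cell` with equal first column differ on
the right by an element of `klingen` (`inv_mul_mem_klingen`), and `cell` is stable under left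
multiplication by `z` (`z_mul_mem_cell`), by a Euclidean descent on the two lower coordinates of the
first column. Stability under the other generators is immediate, so `cell` is all of `Γ`. Hence the
kernel of `φ` lies in `klingen`, where the normal form can be read off the matrix. For surjectivity,
`cell` reaches every unimodular vector, and `klingen` maps onto the stabiliser of the first basis
vector. -/

/-- Five elements of a group that satisfy the defining relations of `Sp₄(ℤ)`. -/
structure Sp4System (Γ : Type*) [Group Γ] where
  s1 : Γ
  s2 : Γ
  s3 : Γ
  s4 : Γ
  s5 : Γ
  c13 : s1 * s3 = s3 * s1
  c14 : s1 * s4 = s4 * s1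
  c15 : s1 * s5 = s5 * s1
  c24 : s2 * s4 = s4 * s2
  c25 : s2 * s5 = s5 * s2
  c35 : s3 * s5 = s5 * s3
  b12 : s1 * s2 * s1 = s2 * s1 * s2
  b23 : s2 * s3 * s2 = s3 * s2 * s3
  b34 : s3 * s4 * s3 = s4 * s3 * s4
  b45 : s4 * s5 * s4 = s5 * s4 * s5
  inv_z : (s1 * s2 * s1) ^ 2 * (s1 * s3⁻¹ * s5) * ((s1 * s2 * s1) ^ 2)⁻¹ = (s1 * s3⁻¹ * s5)⁻¹
  pow_four : (s1 * s2 * s1) ^ 4 = 1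

/-! ### The half-twist in the braid group -/

/-- The Garside half-twist reverses the order of the generators of the braid group
on six strands. -/
theorem exists_semiconjBy_reverse {Γ : Type*} [Group Γ] {s1 s2 s3 s4 s5 : Γ}
    (c13 : s1 * s3 = s3 * s1) (c14 : s1 * s4 = s4 * s1) (c15 : s1 * s5 = s5 * s1)
    (c24 : s2 * s4 = s4 * s2) (c25 : s2 * s5 = s5 * s2) (c35 : s3 * s5 = s5 * s3)
    (b12 : s1 * s2 * s1 = s2 * s1 * s2) (b23 : s2 * s3 * s2 = s3 * s2 * s3)
    (b34 : s3 * s4 * s3 = s4 * s3 * s4) (b45 : s4 * s5 * s4 = s5 * s4 * s5) :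
    ∃ x : Γ, SemiconjBy x s1 s5 ∧ SemiconjBy x s2 s4 ∧ SemiconjBy x s3 s3 ∧
      SemiconjBy x s5 s1 := by
  have key : ∀ {a b : Γ}, a * b * a = b * a * b → SemiconjBy (b * a) b a := by
    intro a b h
    rw [SemiconjBy, ← mul_assoc, h]
  have C : ∀ {a b : Γ}, a * b = b * a → SemiconjBy a b b := fun h => h
  have k12 := key b12
  have k23 := key b23
  have k34 := key b34
  have k45 := key b45
  -- `d k = s_k ⋯ s_1` conjugates `s_{i+1}` to `s_i` for `i < k`
  set d2 := s2 * s1 with hd2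
  set d3 := s3 * d2 with hd3
  set d4 := s4 * d3 with hd4
  set d5 := s5 * d4 with hd5
  have e31 : SemiconjBy d3 s2 s1 := (C c13.symm).mul_left k12
  have e41 : SemiconjBy d4 s2 s1 := (C c14.symm).mul_left e31
  have e51 : SemiconjBy d5 s2 s1 := (C c15.symm).mul_left e41
  have e32 : SemiconjBy d3 s3 s2 := by
    rw [hd3, hd2, ← mul_assoc]; exact k23.mul_left (C c13)
  have e42 : SemiconjBy d4 s3 s2 := (C c24.symm).mul_left e32
  have e52 : SemiconjBy d5 s3 s2 := (C c25.symm).mul_left e42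
  have e43 : SemiconjBy d4 s4 s3 := by
    rw [hd4, hd3, ← mul_assoc]; exact k34.mul_left ((C c24).mul_left (C c14))
  have e53 : SemiconjBy d5 s4 s3 := (C c35.symm).mul_left e43
  have e54 : SemiconjBy d5 s5 s4 := by
    rw [hd5, hd4, ← mul_assoc]
    exact k45.mul_left ((C c35).mul_left ((C c25).mul_left (C c15)))
  -- the half-twists on the first `k` strands
  have f2 : SemiconjBy s1 s1 s1 := rfl
  have f3 : SemiconjBy (s1 * d2) s1 s2 := by
    calc s1 * d2 * s1 = s1 * s2 * s1 * s1 := by simp only [hd2, mul_assoc]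
      _ = s2 * (s1 * d2) := by rw [b12]; simp only [hd2, mul_assoc]
  -- Split the right-hand `d k` as `(s_k ⋯ s_2) * s_1`; the left-hand one shifts `s_k ⋯ s_2` to
  -- `s_{k-1} ⋯ s_1 = d (k-1)`. So `d k * d k = d (k-1) * d k * s_1`, which carries `s_1` through
  -- the last two factors of a half-twist.
  have g3 : d3 * d3 = d2 * d3 * s1 := by
    have : SemiconjBy d3 (s3 * s2) (s2 * s1) := e32.mul_right e31
    rw [hd2, ← this.eq]; simp only [hd3, hd2, mul_assoc]
  have g4 : d4 * d4 = d3 * d4 * s1 := by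
    have : SemiconjBy d4 (s4 * (s3 * s2)) (s3 * (s2 * s1)) :=
      e43.mul_right (e42.mul_right e41)
    rw [hd3, ← this.eq]; simp only [hd4, hd3, hd2, mul_assoc]
  have g5 : d5 * d5 = d4 * d5 * s1 := by
    have : SemiconjBy d5 (s5 * (s4 * (s3 * s2))) (s4 * (s3 * (s2 * s1))) :=
      e54.mul_right (e53.mul_right (e52.mul_right e51))
    rw [hd4, ← this.eq]; simp only [hd5, hd4, hd3, hd2, mul_assoc]
  have f4 : SemiconjBy (s1 * d2 * d3) s1 s3 := by
    have c : Commute s3 s1 := c13.symm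
    calc s1 * d2 * d3 * s1 = s1 * (d2 * d3 * s1) := by simp only [mul_assoc]
      _ = s1 * s3 * (d2 * d3) := by rw [← g3]; nth_rw 1 [hd3]; simp only [mul_assoc]
      _ = s3 * (s1 * d2 * d3) := by rw [← c.eq]; simp only [mul_assoc]
  have f5 : SemiconjBy (s1 * d2 * d3 * d4) s1 s4 := by
    have c : Commute s4 (s1 * d2) :=
      (C c14.symm).mul_right ((C c24.symm).mul_right (C c14.symm))
    calc s1 * d2 * d3 * d4 * s1 = s1 * d2 * (d3 * d4 * s1) := by simp only [mul_assoc]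
      _ = s1 * d2 * s4 * (d3 * d4) := by rw [← g4]; nth_rw 1 [hd4]; simp only [mul_assoc]
      _ = s4 * (s1 * d2 * d3 * d4) := by rw [← c.eq]; simp only [mul_assoc]
  have f6 : SemiconjBy (s1 * d2 * d3 * d4 * d5) s1 s5 := by
    have c' : Commute s5 d2 := (C c25.symm).mul_right (C c15.symm)
    have c : Commute s5 (s1 * d2 * d3) :=
      ((C c15.symm).mul_right c').mul_right ((C c35.symm).mul_right c')
    calc s1 * d2 * d3 * d4 * d5 * s1 = s1 * d2 * d3 * (d4 * d5 * s1) := by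
          simp only [mul_assoc]
      _ = s1 * d2 * d3 * s5 * (d4 * d5) := by
          rw [← g5]; nth_rw 1 [hd5]; simp only [mul_assoc]
      _ = s5 * (s1 * d2 * d3 * d4 * d5) := by rw [← c.eq]; simp only [mul_assoc]
  exact ⟨s1 * d2 * d3 * d4 * d5, f6, f5.mul_left e51, (f4.mul_left e41).mul_left e52,
    (((f2.mul_left k12).mul_left e32).mul_left e43).mul_left e54⟩

/-! ### Root elements and the mirror symmetry -/

namespace Sp4System

variable {Γ : Type*} [Group Γ] (G : Sp4System Γ)

/-- The short root element `U(0, 1; 1, 0)`. -/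
def z : Γ := G.s1 * G.s3⁻¹ * G.s5

/-- The quarter turn of the first hyperbolic plane. -/
def w1 : Γ := G.s1 * G.s2 * G.s1

/-- The quarter turn of the second hyperbolic plane. -/
def w2 : Γ := G.s5 * G.s4 * G.s5

/-- The upper triangular elementary matrix of the Siegel Levi subgroup. -/
def y : Γ := G.w2 * G.z * G.w2⁻¹

/-- The lower triangular elementary matrix of the Siegel Levi subgroup. -/
def y' : Γ := G.w1 * G.z * G.w1⁻¹

/-- The system obtained by reversing the order of the generators. -/
def mirror : Sp4System Γ where
  s1 := G.s5
  s2 := G.s4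
  s3 := G.s3
  s4 := G.s2
  s5 := G.s1
  c13 := G.c35.symm
  c14 := G.c25.symm
  c15 := G.c15.symm
  c24 := G.c24.symm
  c25 := G.c14.symm
  c35 := G.c13.symm
  b12 := G.b45.symm
  b23 := G.b34.symm
  b34 := G.b23.symm
  b45 := G.b12.symm
  -- The two extra relations are stated at one end of the braid only; conjugation by the half-twist
  -- moves them to the other end.
  inv_z := by
    obtain ⟨x, h1, h2, h3, h5⟩ := exists_semiconjBy_reverse G.c13 G.c14 G.c15 G.c24 G.c25 G.c35
      G.b12 G.b23 G.b34 G.b45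
    have hw : SemiconjBy x (G.s1 * G.s2 * G.s1) (G.s5 * G.s4 * G.s5) :=
      (h1.mul_right h2).mul_right h1
    have hz : SemiconjBy x (G.s1 * G.s3⁻¹ * G.s5) (G.s5 * G.s3⁻¹ * G.s1) :=
      (h1.mul_right h3.inv_right).mul_right h5
    have := ((hw.pow_right 2).mul_right hz).mul_right (hw.pow_right 2).inv_right
    have h' := hz.inv_right
    rw [G.inv_z] at this
    exact mul_right_cancel (this.eq.symm.trans h'.eq)
  pow_four := by
    obtain ⟨x, h1, h2, h3, h5⟩ := exists_semiconjBy_reverse G.c13 G.c14 G.c15 G.c24 G.c25 G.c35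
      G.b12 G.b23 G.b34 G.b45
    have hw : SemiconjBy x (G.s1 * G.s2 * G.s1) (G.s5 * G.s4 * G.s5) :=
      (h1.mul_right h2).mul_right h1
    have := (hw.pow_right 4).eq
    rw [G.pow_four] at this
    simpa using this.symm

theorem mirror_z : G.mirror.z = G.z := by
  have h1 : Commute G.s1 G.s3⁻¹ := Commute.inv_right G.c13
  have h2 : Commute G.s5 (G.s1 * G.s3⁻¹) :=
    Commute.mul_right G.c15.symm (Commute.inv_right G.c35.symm)
  change G.s5 * G.s3⁻¹ * G.s1 = G.s1 * G.s3⁻¹ * G.s5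
  rw [mul_assoc, ← h1.eq, h2.eq]

theorem mirror_y : G.mirror.y = G.y' := by
  rw [y, mirror_z]; rfl

theorem mirror_y' : G.mirror.y' = G.y := by
  rw [y', mirror_z]; rfl

theorem w1_s1 : SemiconjBy G.w1 G.s1 G.s2 := by
  rw [SemiconjBy, w1]; nth_rw 1 [G.b12]; simp only [mul_assoc]

theorem w1_s2 : SemiconjBy G.w1 G.s2 G.s1 := by
  rw [SemiconjBy, w1]; nth_rw 2 [G.b12]; simp only [mul_assoc]

theorem w2_s5 : SemiconjBy G.w2 G.s5 G.s4 := G.mirror.w1_s1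

theorem w2_s4 : SemiconjBy G.w2 G.s4 G.s5 := G.mirror.w1_s2

theorem s1_w2 : Commute G.s1 G.w2 := (Commute.mul_right G.c15 G.c14).mul_right G.c15

theorem s2_w2 : Commute G.s2 G.w2 := (Commute.mul_right G.c25 G.c24).mul_right G.c25

theorem w1_w2 : Commute G.w1 G.w2 := ((G.s1_w2).mul_left G.s2_w2).mul_left G.s1_w2

theorem s5_w1 : Commute G.s5 G.w1 := G.mirror.s1_w2

theorem s4_w1 : Commute G.s4 G.w1 := G.mirror.s2_w2

theorem s1_z : Commute G.s1 G.z :=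
  ((Commute.refl _).mul_right (Commute.inv_right G.c13)).mul_right G.c15

theorem s5_z : Commute G.s5 G.z := by
  have := G.mirror.s1_z; rwa [mirror_z] at this

theorem w1_sq_z : SemiconjBy (G.w1 ^ 2) G.z G.z⁻¹ := by
  rw [SemiconjBy, ← mul_inv_eq_iff_eq_mul]; exact G.inv_z

theorem w1_pow_four : G.w1 ^ 4 = 1 := G.pow_four

theorem w2_pow_four : G.w2 ^ 4 = 1 := G.mirror.pow_four

theorem w1_z : SemiconjBy G.w1 G.z G.y' := by
  rw [SemiconjBy, y', inv_mul_cancel_right]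

theorem w2_z : SemiconjBy G.w2 G.z G.y := by
  rw [SemiconjBy, y, inv_mul_cancel_right]

theorem w1_y' : SemiconjBy G.w1 G.y' G.z⁻¹ := by
  have h := G.w1_sq_z.mul_left G.w1_z.inv_symm_left
  rwa [sq, mul_inv_cancel_right] at h

theorem w2_y : SemiconjBy G.w2 G.y G.z⁻¹ := by
  have h := G.mirror.w1_y'; rwa [mirror_z, mirror_y'] at h

/-- As `s5` commutes with `s1`, `s2`, `s3`, this is a braid computation on the first four strands.
Both sides are expressed through `a = s2 * s1⁻¹ * s3 * s2⁻¹`, and `s3 * a = a * s1` matches them. -/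
theorem s2_inv_z : SemiconjBy G.s2⁻¹ G.z (G.z * G.y'⁻¹ * G.s5⁻¹) := by
  have b12 : G.s2⁻¹ * G.s1 * G.s2 = G.s1 * G.s2 * G.s1⁻¹ := by
    rw [mul_assoc, inv_mul_eq_iff_eq_mul, ← mul_assoc, ← mul_assoc, ← G.b12]; group
  have b23 : G.s2⁻¹ * G.s3⁻¹ * G.s2 = G.s3 * G.s2⁻¹ * G.s3⁻¹ := by
    have := G.b23
    rw [mul_assoc, inv_mul_eq_iff_eq_mul, inv_mul_eq_iff_eq_mul]
    simp only [← mul_assoc]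
    rw [← G.b23]; group
  have c13 : Commute G.s1 G.s3 := G.c13
  -- The definition gives `w1 * z⁻¹ * w1⁻¹`; the extra relation that `w1 ^ 2` inverts `z` brings it
  -- to this form.
  have hy : G.y'⁻¹ = G.w1⁻¹ * G.z * G.w1 := by
    have := (G.w1_y'.inv_right).inv_symm_left.eq
    rw [inv_inv] at this
    rw [this, inv_mul_cancel_right]
  -- the pair of strands `{3, 4}` slides past the first two strands
  have slide : G.s3 * (G.s2 * G.s1⁻¹ * G.s3 * G.s2⁻¹) =
      G.s2 * G.s1⁻¹ * G.s3 * G.s2⁻¹ * G.s1 := by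
    calc G.s3 * (G.s2 * G.s1⁻¹ * G.s3 * G.s2⁻¹)
        = G.s3 * G.s2 * (G.s1⁻¹ * G.s3) * G.s2⁻¹ := by group
      _ = G.s3 * G.s2 * G.s3 * G.s1⁻¹ * G.s2⁻¹ := by rw [c13.inv_left.eq]; group
      _ = G.s2 * G.s3 * G.s2 * G.s1⁻¹ * G.s2⁻¹ := by rw [← G.b23]
      _ = G.s2 * (G.s3 * G.s1⁻¹) * (G.s1 * G.s2 * G.s1⁻¹) * G.s2⁻¹ := by group
      _ = _ := by rw [← b12, ← c13.inv_left.eq]; group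
  have h1 : G.s2⁻¹ * G.z * G.s2 = G.s1 * (G.s2 * G.s1⁻¹ * G.s3 * G.s2⁻¹) * G.s3⁻¹ * G.s5 := by
    have c25 : Commute G.s2 G.s5 := G.c25
    calc G.s2⁻¹ * G.z * G.s2 = G.s2⁻¹ * G.s1 * G.s3⁻¹ * (G.s5 * G.s2) := by rw [z]; group
      _ = (G.s2⁻¹ * G.s1 * G.s2) * (G.s2⁻¹ * G.s3⁻¹ * G.s2) * G.s5 := by
          rw [← c25.eq]; group
      _ = _ := by rw [b12, b23]; group
  have h2 : G.w1⁻¹ * (G.s1 * G.s3⁻¹) * G.w1 =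
      (G.s2 * G.s1⁻¹ * G.s3 * G.s2⁻¹) * (G.s3⁻¹ * G.s1) := by
    have h : G.w1⁻¹ * G.s1 * G.w1 = G.s2 := by
      rw [mul_assoc, inv_mul_eq_iff_eq_mul]; exact G.w1_s2.eq.symm
    calc G.w1⁻¹ * (G.s1 * G.s3⁻¹) * G.w1
        = (G.w1⁻¹ * G.s1 * G.w1) * G.s1⁻¹ * (G.s2⁻¹ * (G.s1⁻¹ * G.s3⁻¹ * G.s1) * G.s2) *
          G.s1 := by rw [w1]; group
      _ = G.s2 * G.s1⁻¹ * (G.s2⁻¹ * G.s3⁻¹ * G.s2) * G.s1 := by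
          rw [h, c13.inv_inv.eq]; group
      _ = _ := by rw [b23]; group
  have h3 : G.y'⁻¹ * G.s5⁻¹ = G.w1⁻¹ * (G.s1 * G.s3⁻¹) * G.w1 := by
    rw [hy, z]
    calc _ = G.w1⁻¹ * (G.s1 * G.s3⁻¹) * (G.s5 * G.w1) * G.s5⁻¹ := by group
      _ = _ := by rw [G.s5_w1.eq]; group
  have h4 : G.z = G.s1 * G.s5 * G.s3⁻¹ := by
    have c35 : Commute G.s3 G.s5 := G.c35
    rw [z, mul_assoc, c35.inv_left.eq, mul_assoc]
  rw [SemiconjBy, ← mul_inv_eq_iff_eq_mul, inv_inv, h1, mul_assoc G.z, h3, h2, h4]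
  have h5 : Commute G.s5 (G.s2 * G.s1⁻¹ * G.s3 * G.s2⁻¹ * G.s3⁻¹) := by
    have c35 : Commute G.s5 G.s3 := G.c35.symm
    have c25 : Commute G.s5 G.s2 := G.c25.symm
    have c15 : Commute G.s5 G.s1 := G.c15.symm
    exact (((c25.mul_right c15.inv_right).mul_right c35).mul_right c25.inv_right).mul_right
      c35.inv_right
  set a := G.s2 * G.s1⁻¹ * G.s3 * G.s2⁻¹ with ha
  calc G.s1 * a * G.s3⁻¹ * G.s5 = G.s1 * (a * G.s3⁻¹ * G.s5) := by group
    _ = G.s1 * G.s5 * (G.s3⁻¹ * (G.s3 * a)) * G.s3⁻¹ := by rw [← h5.eq]; group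
    _ = G.s1 * G.s5 * G.s3⁻¹ * a * (G.s1 * G.s3⁻¹) := by rw [slide]; group
    _ = _ := by rw [c13.inv_right.eq]; group

theorem s4_inv_z : SemiconjBy G.s4⁻¹ G.z (G.z * G.y⁻¹ * G.s1⁻¹) := by
  have h := G.mirror.s2_inv_z; rwa [mirror_z, mirror_y'] at h

end Sp4System

/-! ### Commutator formulas and the braid relation in the Siegel Levi subgroup -/

namespace Sp4System

variable {Γ : Type*} [Group Γ] (G : Sp4System Γ)

theorem s1_y : Commute G.s1 G.y := (G.s1_w2.mul_right G.s1_z).mul_right G.s1_w2.inv_right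

theorem s4_y : Commute G.s4 G.y :=
  Commute.symm ((G.w2_s5.mul_left G.s5_z.symm).mul_left G.w2_s5.inv_symm_left)

theorem w2_s1 : SemiconjBy G.w2 G.s1 G.s1 := G.s1_w2.symm

theorem w1_s4 : SemiconjBy G.w1 G.s4 G.s4 := G.s4_w1.symm

theorem w1_s5 : SemiconjBy G.w1 G.s5 G.s5 := G.s5_w1.symm

/-- Conjugate `s4_inv_z` by `w2`, which takes `s4` to `s5`, `z` to `y`, `y` to `z⁻¹` and fixes `s1`.
-/
theorem s5_inv_y : SemiconjBy G.s5⁻¹ G.y (G.y * G.z * G.s1⁻¹) := by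
  have h := ((G.w2_z.mul_right G.w2_y.inv_right).mul_right G.w2_s1.inv_right).mul_left
    (G.s4_inv_z.mul_left G.w2_z.inv_symm_left)
  rw [inv_inv] at h
  have e : G.w2 * (G.s4⁻¹ * G.w2⁻¹) = G.s5⁻¹ := by
    rw [← mul_assoc, G.w2_s4.inv_right.eq, mul_inv_cancel_right]
  rwa [e] at h

theorem s4_z : SemiconjBy G.s4 G.z (G.z * G.y * G.s1) := by
  have h := G.s4_inv_z.inv_symm_left
  rw [inv_inv] at h
  have c : SemiconjBy G.s4 G.s1 G.s1 := G.c14.symm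
  have h' := (h.mul_right c).mul_right G.s4_y
  rwa [inv_mul_cancel_right, inv_mul_cancel_right, mul_assoc, G.s1_y.eq, ← mul_assoc] at h'

theorem s5_y : SemiconjBy G.s5 G.y (G.y * G.z⁻¹ * G.s1) := by
  have h := G.s5_inv_y.inv_symm_left
  rw [inv_inv] at h
  have c : SemiconjBy G.s5 G.s1 G.s1 := G.c15.symm
  have h' := (h.mul_right c).mul_right G.s5_z.inv_right
  rwa [inv_mul_cancel_right, mul_inv_cancel_right, mul_assoc, G.s1_z.inv_right.eq,
    ← mul_assoc] at h'

/-- Conjugate `z` by `w2 = s4 * s5 * s4` in two ways: the result is `y` by definition, and `z * y *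
z⁻¹ * s1 ^ 2` when the three factors are applied in turn. -/
theorem y_z : SemiconjBy G.y G.z (G.z * G.s1 ^ 2) := by
  have c4 : SemiconjBy G.s4 G.s1 G.s1 := G.c14.symm
  have c5 : SemiconjBy G.s5 G.s1 G.s1 := G.c15.symm
  have cz : SemiconjBy G.s5 G.z G.z := G.s5_z
  have h1 := ((cz.mul_right G.s5_y).mul_right c5).mul_left G.s4_z
  have h2 := ((G.s4_z.mul_right ((SemiconjBy.mul_right G.s4_y G.s4_z.inv_right).mul_right
    c4)).mul_right c4).mul_left h1
  have e : G.s4 * (G.s5 * G.s4) = G.w2 := by rw [w2, ← G.b45, mul_assoc]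
  rw [e] at h2
  have h3 := mul_right_cancel (h2.eq.symm.trans G.w2_z.eq)
  have cy : Commute G.s1 G.y := G.s1_y
  have cz : Commute G.s1 G.z := G.s1_z
  have h4 : G.z * G.y * G.s1 * (G.y * (G.z * G.y * G.s1)⁻¹ * G.s1) * G.s1 =
      G.z * G.y * G.z⁻¹ * G.s1 ^ 2 := by
    calc _ = G.z * G.y * (G.s1 * G.y) * G.s1⁻¹ * G.y⁻¹ * G.z⁻¹ * G.s1 ^ 2 := by
          rw [sq]; group
      _ = _ := by rw [cy.eq]; group
  rw [h4] at h3
  calc G.y * G.z = G.z * G.y * G.z⁻¹ * (G.s1 ^ 2 * G.z) := by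
        nth_rw 1 [← h3]; rw [mul_assoc]
    _ = G.z * (G.y * G.s1 ^ 2) := by rw [(cz.pow_left 2).eq]; group
    _ = _ := by rw [← (cy.pow_left 2).eq, mul_assoc]

theorem y_s5 : SemiconjBy G.y G.s5 (G.z * G.s1 * G.s5) := by
  have h : G.y * G.s5 = G.s5 * (G.y * G.z) * G.s1⁻¹ := by
    have := congrArg (fun t => G.s5 * t * G.s5) G.s5_inv_y.eq
    simpa [mul_assoc] using this
  have c1 : Commute G.s1 G.y := G.s1_y
  have c5 : Commute G.s5 (G.z * G.s1) := G.s5_z.mul_right G.c15.symm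
  calc _ = G.s5 * (G.z * G.s1) * (G.s1 * G.y) * G.s1⁻¹ := by rw [h, G.y_z.eq, sq]; group
    _ = _ := by rw [c1.eq, c5.eq]; group

theorem y_s1 : SemiconjBy G.y G.s1 G.s1 := G.s1_y.symm

theorem y'_s5 : SemiconjBy G.y' G.s5 G.s5 := by
  have h := G.mirror.y_s1; rwa [mirror_y] at h

theorem y'_z : SemiconjBy G.y' G.z (G.z * G.s5 ^ 2) := by
  have h := G.mirror.y_z; rwa [mirror_y, mirror_z] at h

theorem y'_s1 : SemiconjBy G.y' G.s1 (G.z * G.s5 * G.s1) := by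
  have h := G.mirror.y_s5; rwa [mirror_y, mirror_z] at h

theorem y'_inv_z : SemiconjBy G.y'⁻¹ G.z (G.z * (G.s5 ^ 2)⁻¹) := by
  have h := (G.y'_z.mul_right (G.y'_s5.pow_right 2).inv_right).inv_symm_left
  rwa [mul_inv_cancel_right] at h

theorem y'_inv_s1 : SemiconjBy G.y'⁻¹ G.s1 (G.s5 * G.z⁻¹ * G.s1) := by
  have h := ((G.y'_s5.mul_right G.y'_z.inv_right).mul_right G.y'_s1).inv_symm_left
  have c : Commute G.s5 G.z := G.s5_z
  have e : G.s5 * (G.z * G.s5 ^ 2)⁻¹ * (G.z * G.s5 * G.s1) = G.s1 := by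
    calc _ = G.s5⁻¹ * G.z⁻¹ * (G.z * G.s5) * G.s1 := by group
      _ = _ := by group
  rwa [e] at h

/-- The quarter turn of the Siegel Levi subgroup. -/
def wL : Γ := G.y * G.y'⁻¹ * G.y

theorem mirror_wL : G.mirror.wL = G.y' * G.y⁻¹ * G.y' := by
  rw [wL, mirror_y, mirror_y']

theorem wL_s1 : SemiconjBy G.wL G.s1 G.s5 := by
  have h := ((G.y_s5.mul_right G.y_z.inv_right).mul_right G.y_s1).mul_left
    (G.y'_inv_s1.mul_left G.y_s1)
  have c1 : Commute G.s1 G.z := G.s1_z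
  have e : G.z * G.s1 * G.s5 * (G.z * G.s1 ^ 2)⁻¹ * G.s1 = G.s5 := by
    have c : Commute G.s5 ((G.z * G.s1 ^ 2)⁻¹ * G.s1) :=
      (G.s5_z.mul_right (Commute.pow_right G.c15.symm 2)).inv_right.mul_right G.c15.symm
    rw [mul_assoc, mul_assoc, c.eq, (c1.pow_left 2).symm.eq]
    calc _ = G.z * (G.s1 * G.z⁻¹) * G.s1⁻¹ * G.s5 := by group
      _ = _ := by rw [c1.inv_right.eq]; group
  rwa [e, ← mul_assoc] at h

theorem wL_z : SemiconjBy G.wL G.z G.z⁻¹ := by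
  have h1 : SemiconjBy G.y'⁻¹ (G.z * G.s1 ^ 2) (G.z⁻¹ * G.s1 ^ 2) := by
    have h := G.y'_inv_z.mul_right (G.y'_inv_s1.pow_right 2)
    have c5 : Commute G.s5 G.z⁻¹ := G.s5_z.inv_right
    have c1 : Commute (G.s5 * G.z⁻¹) G.s1 :=
      Commute.mul_left G.c15.symm G.s1_z.symm.inv_left
    rw [c1.mul_pow, c5.mul_pow] at h
    have e : G.z * (G.s5 ^ 2)⁻¹ * (G.s5 ^ 2 * G.z⁻¹ ^ 2 * G.s1 ^ 2) = G.z⁻¹ * G.s1 ^ 2 := by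
      group
    rwa [e] at h
  have h := (G.y_z.inv_right.mul_right (G.y_s1.pow_right 2)).mul_left (h1.mul_left G.y_z)
  have e : (G.z * G.s1 ^ 2)⁻¹ * G.s1 ^ 2 = G.z⁻¹ := by
    have c1 : Commute G.s1 G.z := G.s1_z
    rw [← (c1.pow_left 2).eq]; group
  rwa [e, ← mul_assoc] at h

theorem wL_s5 : SemiconjBy G.wL G.s5 G.s1 := by
  have h1 : SemiconjBy G.y'⁻¹ (G.z * G.s1 * G.s5) G.s1 := by
    have h := (G.y'_inv_z.mul_right G.y'_inv_s1).mul_right G.y'_s5.inv_symm_left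
    have c5 : Commute G.s5 (G.z⁻¹ * G.s1) :=
      G.s5_z.inv_right.mul_right G.c15.symm
    have e : G.z * (G.s5 ^ 2)⁻¹ * (G.s5 * G.z⁻¹ * G.s1) * G.s5 = G.s1 := by
      rw [mul_assoc G.s5, mul_assoc, mul_assoc G.s5, ← c5.eq]; group
    rwa [e] at h
  have h := G.y_s1.mul_left (h1.mul_left G.y_s5)
  rwa [← mul_assoc] at h

theorem w1_w2_y : SemiconjBy (G.w1 * G.w2) G.y G.y'⁻¹ := G.w1_z.inv_right.mul_left G.w2_y

theorem w1_w2_y' : SemiconjBy (G.w1 * G.w2) G.y' G.y⁻¹ := by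
  rw [G.w1_w2.eq]; exact G.w2_z.inv_right.mul_left G.w1_y'

/-- Before the braid relation is known for `y` and `y'`, the two candidates for the quarter turn
are distinguished. -/
theorem wL_conj : SemiconjBy (G.w1 * G.w2) G.wL (G.y'⁻¹ * G.y * G.y'⁻¹) := by
  have h := (G.w1_w2_y.mul_right G.w1_w2_y'.inv_right).mul_right G.w1_w2_y
  rwa [inv_inv] at h

/-- The conjugating element is the inverse of the mirror image of `wL`. -/
theorem inv_mul_mul_inv_s5 : SemiconjBy (G.y'⁻¹ * G.y * G.y'⁻¹) G.s5 G.s1 := by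
  have h : SemiconjBy G.mirror.wL⁻¹ G.s5 G.s1 := G.mirror.wL_s5.inv_symm_left
  rw [mirror_wL] at h
  simpa [mul_assoc] using h

theorem inv_mul_mul_inv_z : SemiconjBy (G.y'⁻¹ * G.y * G.y'⁻¹) G.z G.z⁻¹ := by
  have h := G.mirror.wL_z.inv_symm_left.inv_right
  rw [mirror_wL, mirror_z] at h
  simpa [mul_assoc] using h

theorem conj_trans {w a b x x' t t' : Γ} (h : SemiconjBy w a b) (hx : SemiconjBy w x x')
    (ht : SemiconjBy w t t') (ha : SemiconjBy a x t) : SemiconjBy b x' t' := by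
  have := (ht.mul_left ha).mul_left hx.inv_symm_left
  rwa [h.eq, mul_inv_cancel_right] at this

/-- Conjugating `wL_s1` by `w1 * w2` turns `s1`, `s5` into `s2`, `s4`. Thus the second candidate has
a known action on `s4` as well as on `s5` and `z`, hence on `w2` and `y`. -/
theorem inv_mul_mul_inv_s2 : SemiconjBy (G.y'⁻¹ * G.y * G.y'⁻¹) G.s2 G.s4 :=
  conj_trans G.wL_conj (G.w1_s1.mul_left G.w2_s1) (G.w1_s4.mul_left G.w2_s5) G.wL_s1

theorem inv_mul_mul_inv_s4 : SemiconjBy (G.y'⁻¹ * G.y * G.y'⁻¹) G.s4 G.s2 :=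
  conj_trans G.wL_conj (G.w1_s4.mul_left G.w2_s5) (G.w1_s1.mul_left G.w2_s1) G.wL_s5

theorem inv_mul_mul_inv_w2 : SemiconjBy (G.y'⁻¹ * G.y * G.y'⁻¹) G.w2 G.w1 :=
  (G.inv_mul_mul_inv_s5.mul_right G.inv_mul_mul_inv_s4).mul_right G.inv_mul_mul_inv_s5

/-- The braid relation of the Siegel Levi subgroup. -/
theorem wL_eq : G.wL = G.y'⁻¹ * G.y * G.y'⁻¹ := by
  -- The element takes `w2` to `w1` and `z` to `z⁻¹`, so it takes `y = w2 * z * w2⁻¹` to `w1 * z⁻¹ *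
  -- w1⁻¹ = y'⁻¹`. Cancelling one `y'⁻¹` leaves the braid relation.
  have h : SemiconjBy (G.y'⁻¹ * G.y * G.y'⁻¹) G.y G.y'⁻¹ := by
    have h1 := (G.inv_mul_mul_inv_w2.mul_right G.inv_mul_mul_inv_z).mul_right
      G.inv_mul_mul_inv_w2.inv_right
    rwa [G.w1_z.inv_right.eq, mul_inv_cancel_right] at h1
  have := h.eq
  rw [wL]
  apply mul_left_cancel (a := G.y'⁻¹)
  rw [← this]; simp only [mul_assoc]

theorem wL_w1 : SemiconjBy G.wL G.w1 G.w2 := by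
  have h : SemiconjBy G.wL G.s2 G.s4 := by rw [wL_eq]; exact G.inv_mul_mul_inv_s2
  exact (G.wL_s1.mul_right h).mul_right G.wL_s1

theorem w1_sq_y : SemiconjBy (G.w1 ^ 2) G.y G.y⁻¹ := by
  have c : SemiconjBy (G.w1 ^ 2) G.w2 G.w2 := G.w1_w2.pow_left 2
  have h := (c.mul_right G.w1_sq_z).mul_right c.inv_right
  have e : G.w2 * G.z⁻¹ * G.w2⁻¹ = G.y⁻¹ := by rw [y]; group
  rwa [e] at h

theorem w1_sq_y' : SemiconjBy (G.w1 ^ 2) G.y' G.y'⁻¹ := by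
  have c : SemiconjBy (G.w1 ^ 2) G.w1 G.w1 := (Commute.refl G.w1).pow_left 2
  have h := (c.mul_right G.w1_sq_z).mul_right c.inv_right
  have e : G.w1 * G.z⁻¹ * G.w1⁻¹ = G.y'⁻¹ := by rw [y']; group
  rwa [e] at h

theorem w1_sq_inv : (G.w1 ^ 2)⁻¹ = G.w1 ^ 2 := by
  rw [inv_eq_iff_mul_eq_one, ← pow_add]; exact G.w1_pow_four

/-- `w1 ^ 2` inverts `wL`, while `wL` carries `w1 ^ 2` to `w2 ^ 2`; comparing the two gives `w2 ^ 2
* wL ^ 2 = w1 ^ 2`. -/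
theorem wL_sq : G.wL ^ 2 = G.w1 ^ 2 * G.w2 ^ 2 := by
  have h1 : SemiconjBy (G.w1 ^ 2) G.wL G.wL⁻¹ := by
    have h := (G.w1_sq_y.mul_right G.w1_sq_y'.inv_right).mul_right G.w1_sq_y
    simpa [wL, mul_assoc] using h
  have h2 : SemiconjBy G.wL (G.w1 ^ 2) (G.w2 ^ 2) := G.wL_w1.pow_right 2
  have h3 : G.w2 ^ 2 * G.wL ^ 2 = G.w1 ^ 2 := by
    rw [sq G.wL, ← mul_assoc, ← h2.eq, mul_assoc, h1.eq, mul_inv_cancel_left]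
  have c : Commute (G.w1 ^ 2) (G.w2 ^ 2) := G.w1_w2.pow_pow 2 2
  rw [c.eq, ← h3, ← mul_assoc, ← pow_add, G.w2_pow_four, one_mul]

theorem wL_pow_four : G.wL ^ 4 = 1 := by
  have c : Commute (G.w1 ^ 2) (G.w2 ^ 2) := G.w1_w2.pow_pow 2 2
  rw [show 4 = 2 * 2 from rfl, pow_mul, wL_sq, c.mul_pow, ← pow_mul, ← pow_mul, w1_pow_four,
    w2_pow_four, one_mul]

end Sp4System

/-! ### The presentation of `SL₂(ℤ)` by positive words -/

section SpecialLinear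

open ModularGroup Matrix

open Matrix in
/-- The lower triangular elementary matrix of `SL₂(ℤ)`. -/
def lowerT : SpecialLinearGroup (Fin 2) ℤ := ⟨!![1, 0; 1, 1], by simp [det_fin_two]⟩

theorem coe_lowerT : (lowerT : Matrix (Fin 2) (Fin 2) ℤ) = !![1, 0; 1, 1] := rfl

theorem T_lowerT_T : T * lowerT⁻¹ * T = S⁻¹ := by
  apply Subtype.ext
  simp [coe_T, coe_S, coe_lowerT, adjugate_fin_two_of]

theorem lowerT_T_lowerT : lowerT⁻¹ * T * lowerT⁻¹ = S⁻¹ := by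
  apply Subtype.ext
  simp [coe_T, coe_S, coe_lowerT, adjugate_fin_two_of]

theorem S_sq : S ^ 2 = -1 := by
  apply Subtype.ext
  ext i j; fin_cases i <;> fin_cases j <;> simp [sq, coe_S]

theorem S_pow_four : S ^ 4 = 1 := by
  rw [show 4 = 2 * 2 from rfl, pow_mul, S_sq]; simp

section NormalForm

variable {Γ : Type*} [Group Γ] {u l w : Γ}

/-- The elements `w ^ a * m * w ^ b` with `m` a positive word in `u` and `l`. -/
def IsTwisted (u l w g : Γ) : Prop :=
  ∃ a b : ℕ, ∃ m ∈ Submonoid.closure {u, l}, g = w ^ a * m * w ^ b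

theorem IsTwisted.pow_mul {g : Γ} (hg : IsTwisted u l w g) (n : ℕ) :
    IsTwisted u l w (w ^ n * g) := by
  obtain ⟨a, b, m, hm, rfl⟩ := hg
  exact ⟨n + a, b, m, hm, by rw [pow_add]; simp only [mul_assoc]⟩

theorem IsTwisted.mul_pow {g : Γ} (hg : IsTwisted u l w g) (n : ℕ) :
    IsTwisted u l w (g * w ^ n) := by
  obtain ⟨a, b, m, hm, rfl⟩ := hg
  exact ⟨a, b + n, m, hm, by rw [pow_add]; simp only [mul_assoc]⟩

theorem IsTwisted.of_mem {m : Γ} (hm : m ∈ Submonoid.closure {u, l}) : IsTwisted u l w m :=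
  ⟨0, 0, m, hm, by simp⟩

/-- An inverse letter in front of a positive word cancels against `l` or, before `u`, becomes `l` at
the cost of a power of `w`. The exponent `n` is free so that the roles of `u` and `l` can be
exchanged: it is `1` for `l⁻¹` and `3` for `u⁻¹`. -/
theorem isTwisted_inv_mul {n : ℕ} (hl : w ^ n * l = l⁻¹ * u) (hul : l⁻¹ = w * u * w ^ 3)
    {m : Γ} (hm : m ∈ Submonoid.closure {u, l}) : IsTwisted u l w (l⁻¹ * m) := by
  have hu : u ∈ Submonoid.closure {u, l} := Submonoid.subset_closure (by simp)
  have hl' : l ∈ Submonoid.closure {u, l} := Submonoid.subset_closure (by simp)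
  induction hm using Submonoid.closure_induction_left with
  | one => exact ⟨1, 3, u, hu, by rw [mul_one, hul, pow_one]⟩
  | mul_left x hx y hy _ =>
    rcases hx with rfl | rfl
    · refine ⟨n, 0, l * y, mul_mem hl' hy, ?_⟩
      rw [← mul_assoc, ← hl]; simp [mul_assoc]
    · rw [inv_mul_cancel_left]; exact .of_mem hy

theorem IsTwisted.symm {g : Γ} (hg : IsTwisted u l w g) : IsTwisted l u w g := by
  rwa [IsTwisted, Set.pair_comm]

/-- Conjugation by `w` takes `u` to `l⁻¹` and `l` to `u⁻¹`. So a letter moved past `w ^ a` is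
unchanged for even `a` and becomes the inverse of the other letter for odd `a`. -/
theorem isTwisted_mul_left (h : u * l⁻¹ * u = l⁻¹ * u * l⁻¹) (hw : w = u * l⁻¹ * u)
    (h4 : w ^ 4 = 1) {g : Γ} (hg : IsTwisted u l w g) :
    IsTwisted u l w (u * g) ∧ IsTwisted u l w (l * g) := by
  have hw' : w = l⁻¹ * u * l⁻¹ := hw.trans h
  have h3 : w⁻¹ = w ^ 3 := inv_eq_of_mul_eq_one_right (by rw [← pow_succ', h4])
  have su : SemiconjBy w u l⁻¹ := by
    rw [SemiconjBy]; nth_rw 1 [hw']; rw [hw]; group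
  have sl : SemiconjBy w l u⁻¹ := by
    rw [SemiconjBy]; nth_rw 1 [hw']; rw [hw]; group
  have hl {m : Γ} (hm : m ∈ Submonoid.closure {u, l}) : IsTwisted u l w (l⁻¹ * m) := by
    refine isTwisted_inv_mul (n := 1) ?_ ?_ hm
    · rw [pow_one, hw']; group
    · rw [← h3, su.eq, mul_inv_cancel_right]
  have hu {m : Γ} (hm : m ∈ Submonoid.closure {u, l}) : IsTwisted u l w (u⁻¹ * m) := by
    refine (isTwisted_inv_mul (n := 3) ?_ ?_ (by rwa [Set.pair_comm])).symm
    · rw [← h3, hw]; group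
    · rw [← h3, sl.eq, mul_inv_cancel_right]
  obtain ⟨a, b, m, hm, rfl⟩ := hg
  have mu : u ∈ Submonoid.closure {u, l} := Submonoid.subset_closure (by simp)
  have ml : l ∈ Submonoid.closure {u, l} := Submonoid.subset_closure (by simp)
  have key (x y : Γ) (hx : x ∈ Submonoid.closure {u, l}) (hxy : SemiconjBy w y⁻¹ x)
      (hyx : SemiconjBy w x y⁻¹)
      (hy : IsTwisted u l w (y⁻¹ * m)) : IsTwisted u l w (x * (w ^ a * m * w ^ b)) := by
    have hc : Commute (w ^ 2) x := by rw [sq]; exact hxy.mul_left hyx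
    rcases Nat.even_or_odd' a with ⟨c, rfl | rfl⟩
    · have := (hc.pow_left c).eq
      rw [← pow_mul] at this
      rw [← mul_assoc, ← mul_assoc, ← this, mul_assoc _ x]
      exact ((IsTwisted.of_mem (mul_mem hx hm)).pow_mul _).mul_pow _
    · have := (SemiconjBy.mul_left (hc.pow_left c) hxy).eq
      rw [← pow_mul, ← pow_succ] at this
      rw [← mul_assoc, ← mul_assoc, ← this, mul_assoc _ y⁻¹]
      exact (hy.pow_mul _).mul_pow _
  refine ⟨key u l mu ?_ su (hl hm), key l u ml ?_ sl (hu hm)⟩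
  · simpa using sl.inv_right
  · simpa using su.inv_right

theorem isTwisted_of_mem_closure (h : u * l⁻¹ * u = l⁻¹ * u * l⁻¹) (hw : w = u * l⁻¹ * u)
    (h4 : w ^ 4 = 1) {g : Γ} (hg : g ∈ Subgroup.closure {u, l}) : IsTwisted u l w g := by
  have hw' : w = l⁻¹ * u * l⁻¹ := hw.trans h
  have h3 : w⁻¹ = w ^ 3 := inv_eq_of_mul_eq_one_right (by rw [← pow_succ', h4])
  have su : u⁻¹ = w * l * w ^ 3 := by
    rw [← h3]; nth_rw 1 [hw']; rw [hw]; group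
  have sl : l⁻¹ = w * u * w ^ 3 := by
    rw [← h3]; nth_rw 1 [hw']; rw [hw]; group
  induction hg using Subgroup.closure_induction_left with
  | one => exact .of_mem (one_mem _)
  | mul_left x hx y _ ih =>
    rcases hx with rfl | rfl
    · exact (isTwisted_mul_left h hw h4 ih).1
    · exact (isTwisted_mul_left h hw h4 ih).2
  | inv_mul_cancel x hx y _ ih =>
    have ih' := isTwisted_mul_left h hw h4 (ih.pow_mul 3)
    rcases hx with rfl | rfl
    · rw [su, mul_assoc, mul_assoc]; simpa using ih'.2.pow_mul 1
    · rw [sl, mul_assoc, mul_assoc]; simpa using ih'.1.pow_mul 1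

/-- Each letter adds one row to the other. The bounds on the row sums feed the induction: after any
letter the total is at least `2 + 1`. -/
theorem positive_entries (f : Γ →* SpecialLinearGroup (Fin 2) ℤ) (hu : f u = T)
    (hl : f l = lowerT) {m : Γ} (hm : m ∈ Submonoid.closure {u, l}) :
    (∀ i j, 0 ≤ f m i j) ∧ 1 ≤ f m 0 0 + f m 0 1 ∧ 1 ≤ f m 1 0 + f m 1 1 ∧
      (m = 1 ∨ 3 ≤ f m 0 0 + f m 0 1 + f m 1 0 + f m 1 1) := by
  induction hm using Submonoid.closure_induction_left with
  | one =>
    refine ⟨fun i j => ?_, by simp, by simp, Or.inl rfl⟩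
    fin_cases i <;> fin_cases j <;> simp
  | mul_left x hx y _ ih =>
    obtain ⟨h0, h1, h2, -⟩ := ih
    have := h0 0 0
    have := h0 0 1
    have := h0 1 0
    have := h0 1 1
    rcases hx with rfl | rfl
    · have e00 : f (x * y) 0 0 = f y 0 0 + f y 1 0 := by
        simp [hu, vecMul, dotProduct, Fin.sum_univ_two]
      have e01 : f (x * y) 0 1 = f y 0 1 + f y 1 1 := by
        simp [hu, vecMul, dotProduct, Fin.sum_univ_two]
      have e10 : f (x * y) 1 0 = f y 1 0 := by
        simp [hu]
      have e11 : f (x * y) 1 1 = f y 1 1 := by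
        simp [hu]
      refine ⟨?_, by omega, by omega, Or.inr (by omega)⟩
      simp only [Fin.forall_fin_two]; omega
    · have e00 : f (x * y) 0 0 = f y 0 0 := by
        simp [hl, coe_lowerT, Matrix.mul_apply, Fin.sum_univ_two]
      have e01 : f (x * y) 0 1 = f y 0 1 := by
        simp [hl, coe_lowerT, Matrix.mul_apply, Fin.sum_univ_two]
      have e10 : f (x * y) 1 0 = f y 0 0 + f y 1 0 := by
        simp [hl, coe_lowerT, Matrix.mul_apply, Fin.sum_univ_two]
      have e11 : f (x * y) 1 1 = f y 0 1 + f y 1 1 := by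
        simp [hl, coe_lowerT, Matrix.mul_apply, Fin.sum_univ_two]
      refine ⟨?_, by omega, by omega, Or.inr (by omega)⟩
      simp only [Fin.forall_fin_two]; omega

/-- In the form `w ^ a * m * w ^ b`, the hypothesis reads `f m = S ^ (a + b)`. Only the trivial
power of `S` has no negative entry, and its entry sum `2` forces `m = 1`; then `w ^ 4 = 1` finishes.
-/
theorem eq_one_of_mem_closure (h : u * l⁻¹ * u = l⁻¹ * u * l⁻¹) (h4 : (u * l⁻¹ * u) ^ 4 = 1)
    (f : Γ →* SpecialLinearGroup (Fin 2) ℤ) (hu : f u = T) (hl : f l = lowerT) {g : Γ}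
    (hg : g ∈ Subgroup.closure {u, l}) (hfg : f g = 1) : g = 1 := by
  obtain ⟨a, b, m, hm, rfl⟩ := isTwisted_of_mem_closure h rfl h4 hg
  set w := u * l⁻¹ * u with hw
  have hfw : f w = S⁻¹ := by rw [hw]; simp only [map_mul, map_inv, hu, hl, T_lowerT_T]
  obtain ⟨h0, -, -, h3⟩ := positive_entries f hu hl hm
  have hm' : f m = S ^ (a + b) := by
    rw [map_mul, map_mul, map_pow, map_pow, hfw, mul_eq_one_iff_eq_inv, inv_pow, inv_pow,
      inv_inv, inv_mul_eq_iff_eq_mul, ← pow_add] at hfg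
    exact hfg
  have h00 := h0 0 0
  have h01 := h0 0 1
  have h10 := h0 1 0
  have h11 := h0 1 1
  rw [← Nat.div_add_mod (a + b) 4, pow_add, pow_mul, S_pow_four, one_pow, one_mul] at hm'
  have hr : (a + b) % 4 < 4 := Nat.mod_lt _ (by norm_num)
  have hr0 : (a + b) % 4 = 0 := by
    generalize (a + b) % 4 = r at hm' hr
    interval_cases r
    · rfl
    · rw [hm'] at h01; simp [coe_S] at h01
    · rw [hm', S_sq] at h00; simp at h00
    · rw [hm', pow_succ, S_sq] at h10; simp [coe_S] at h10
  rw [hr0, pow_zero] at hm'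
  rcases h3 with rfl | h3
  · rw [mul_one, ← pow_add, ← Nat.div_add_mod (a + b) 4, pow_add, pow_mul, h4, hr0]; simp
  · rw [hm'] at h3; simp at h3

/-- `SL₂(ℤ)` is presented by the generators `u` and `l` subject to the braid relation between `u`
and `l⁻¹` and to `(u * l⁻¹ * u) ^ 4 = 1`. -/
theorem exists_hom_SL2Z (h : u * l⁻¹ * u = l⁻¹ * u * l⁻¹) (h4 : (u * l⁻¹ * u) ^ 4 = 1) :
    ∃ ψ : SpecialLinearGroup (Fin 2) ℤ →* Γ, ψ T = u ∧ ψ lowerT = l := by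
  have hTl : T * lowerT⁻¹ * T = lowerT⁻¹ * T * lowerT⁻¹ := by rw [T_lowerT_T, lowerT_T_lowerT]
  have hT4 : (T * lowerT⁻¹ * T) ^ 4 = 1 := by rw [T_lowerT_T, inv_pow, S_pow_four, inv_one]
  let U : Γ × SpecialLinearGroup (Fin 2) ℤ := (u, T)
  let L : Γ × SpecialLinearGroup (Fin 2) ℤ := (l, lowerT)
  -- `D` is to be the graph of the homomorphism. Both components satisfy the relations, so the lemma
  -- on words applies in the product group and makes the projection to `SL₂(ℤ)` injective.
  let D := Subgroup.closure {U, L}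
  have hU : U ∈ D := Subgroup.subset_closure (by simp)
  have hL : L ∈ D := Subgroup.subset_closure (by simp)
  let p : D →* SpecialLinearGroup (Fin 2) ℤ := (MonoidHom.snd _ _).comp D.subtype
  have hinj : Function.Injective p := by
    rw [injective_iff_map_eq_one]
    intro g hg
    exact Subtype.ext (eq_one_of_mem_closure (u := U) (l := L) (Prod.ext h hTl) (Prod.ext h4 hT4)
      (MonoidHom.snd _ _) rfl rfl g.2 hg)
  have hsurj : Function.Surjective p := by
    rw [← MonoidHom.range_eq_top, eq_top_iff, ← SpecialLinearGroup.SL2Z_generators,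
      Subgroup.closure_le]
    have hT : T ∈ p.range := ⟨⟨U, hU⟩, rfl⟩
    have hl : lowerT ∈ p.range := ⟨⟨L, hL⟩, rfl⟩
    rintro x (rfl | rfl)
    · rw [SetLike.mem_coe, ← inv_inv S, ← T_lowerT_T]
      exact inv_mem (mul_mem (mul_mem hT (inv_mem hl)) hT)
    · exact hT
  let e := MulEquiv.ofBijective p ⟨hinj, hsurj⟩
  refine ⟨((MonoidHom.fst _ _).comp D.subtype).comp e.symm.toMonoidHom, ?_, ?_⟩
  · have : e.symm T = ⟨U, hU⟩ := by rw [MulEquiv.symm_apply_eq]; rfl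
    simp [this, U]
  · have : e.symm lowerT = ⟨L, hL⟩ := by rw [MulEquiv.symm_apply_eq]; rfl
    simp [this, L]

end NormalForm

theorem closure_T_lowerT : Subgroup.closure {T, lowerT} = ⊤ := by
  rw [eq_top_iff, ← SpecialLinearGroup.SL2Z_generators, Subgroup.closure_le]
  have hT : T ∈ Subgroup.closure {T, lowerT} := Subgroup.subset_closure (by simp)
  have hl : lowerT ∈ Subgroup.closure {T, lowerT} := Subgroup.subset_closure (by simp)
  rintro x (rfl | rfl)
  · rw [SetLike.mem_coe, ← inv_inv S, ← T_lowerT_T]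
    exact inv_mem (mul_mem (mul_mem hT (inv_mem hl)) hT)
  · exact hT

theorem exists_eq_T_zpow {A : SpecialLinearGroup (Fin 2) ℤ} (h0 : A 0 0 = 1) (h1 : A 1 0 = 0) :
    ∃ n : ℤ, A = T ^ n := by
  have hd := A.det_coe
  rw [det_fin_two, h0, h1] at hd
  refine ⟨A 0 1, Subtype.ext ?_⟩
  rw [coe_T_zpow]
  ext i j; fin_cases i <;> fin_cases j
  · simpa using h0
  · simp
  · simpa using h1
  · simpa using hd

theorem exists_eq_T_zpow_or {A : SpecialLinearGroup (Fin 2) ℤ} (h1 : A 1 0 = 0) :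
    ∃ n : ℤ, A = T ^ n ∨ A = T ^ n * S ^ 2 := by
  have hd := A.det_coe
  rw [det_fin_two, h1, mul_zero, sub_zero] at hd
  rcases Int.eq_one_or_neg_one_of_mul_eq_one hd with h | h
  · obtain ⟨n, hn⟩ := exists_eq_T_zpow h h1
    exact ⟨n, .inl hn⟩
  · obtain ⟨n, hn⟩ := exists_eq_T_zpow (A := -A) (by simp [h]) (by simp [h1])
    exact ⟨n, .inr (by rw [S_sq, ← hn]; simp)⟩

/-- Both `x` and `x⁻¹` are tested, since conjugation by `x` alone could map the subgroup into a
proper part of itself. -/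
theorem Subgroup.mem_normalizer_closure {Γ : Type*} [Group Γ] {s : Set Γ} {x : Γ}
    (h : ∀ y ∈ s, ∃ y' ∈ Subgroup.closure s, SemiconjBy x y y')
    (h' : ∀ y ∈ s, ∃ y' ∈ Subgroup.closure s, SemiconjBy x⁻¹ y y') :
    x ∈ Subgroup.normalizer (Subgroup.closure s : Set Γ) := by
  have key : ∀ x : Γ, (∀ y ∈ s, ∃ y' ∈ Subgroup.closure s, SemiconjBy x y y') →
      ∀ y ∈ Subgroup.closure s, x * y * x⁻¹ ∈ Subgroup.closure s := by
    intro x hx y hy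
    have : Subgroup.closure s ≤ (Subgroup.closure s).comap (MulAut.conj x).toMonoidHom := by
      rw [Subgroup.closure_le]
      intro y hy
      obtain ⟨y', hy', e⟩ := hx y hy
      simpa [e.eq] using hy'
    simpa using this hy
  rw [Subgroup.mem_normalizer_iff]
  refine fun y => ⟨key x h y, fun hy => ?_⟩
  have := key x⁻¹ h' _ hy
  simpa [mul_assoc] using this

/-! ### The three maps from `SL₂(ℤ)` and the parabolic subgroups -/

namespace Sp4System

variable {Γ : Type*} [Group Γ] (G : Sp4System Γ)

theorem exists_psi1 : ∃ ψ : SpecialLinearGroup (Fin 2) ℤ →* Γ, ψ T = G.s1 ∧ ψ lowerT = G.s2⁻¹ :=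
  exists_hom_SL2Z (by rw [inv_inv]; exact G.b12) (by rw [inv_inv]; exact G.pow_four)

theorem exists_psiL : ∃ ψ : SpecialLinearGroup (Fin 2) ℤ →* Γ, ψ T = G.y ∧ ψ lowerT = G.y' :=
  exists_hom_SL2Z G.wL_eq G.wL_pow_four

/-- The long root `SL₂(ℤ)` of the first hyperbolic plane. -/
noncomputable def psi1 : SpecialLinearGroup (Fin 2) ℤ →* Γ := G.exists_psi1.choose

/-- The long root `SL₂(ℤ)` of the second hyperbolic plane. -/
noncomputable def psi2 : SpecialLinearGroup (Fin 2) ℤ →* Γ := G.mirror.psi1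

/-- The short root `SL₂(ℤ)` of the Siegel Levi subgroup. -/
noncomputable def psiL : SpecialLinearGroup (Fin 2) ℤ →* Γ := G.exists_psiL.choose

theorem psi1_T : G.psi1 T = G.s1 := G.exists_psi1.choose_spec.1

theorem psi1_lowerT : G.psi1 lowerT = G.s2⁻¹ := G.exists_psi1.choose_spec.2

theorem psi2_T : G.psi2 T = G.s5 := G.mirror.psi1_T

theorem psi2_lowerT : G.psi2 lowerT = G.s4⁻¹ := G.mirror.psi1_lowerT

theorem psiL_T : G.psiL T = G.y := G.exists_psiL.choose_spec.1

theorem psiL_lowerT : G.psiL lowerT = G.y' := G.exists_psiL.choose_spec.2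

theorem psi1_S : G.psi1 S = G.w1⁻¹ := by
  rw [← inv_inv S, ← T_lowerT_T]; simp [psi1_T, psi1_lowerT, w1, mul_assoc]

theorem psi2_S : G.psi2 S = G.w2⁻¹ := G.mirror.psi1_S

theorem psiL_S : G.psiL S = G.wL⁻¹ := by
  rw [← inv_inv S, ← T_lowerT_T]; simp [psiL_T, psiL_lowerT, wL, mul_assoc]

theorem range_psi1 : G.psi1.range = Subgroup.closure {G.s1, G.s2⁻¹} := by
  rw [MonoidHom.range_eq_map, ← closure_T_lowerT, MonoidHom.map_closure, Set.image_pair, psi1_T,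
    psi1_lowerT]

theorem range_psi2 : G.psi2.range = Subgroup.closure {G.s5, G.s4⁻¹} := G.mirror.range_psi1

theorem range_psiL : G.psiL.range = Subgroup.closure {G.y, G.y'} := by
  rw [MonoidHom.range_eq_map, ← closure_T_lowerT, MonoidHom.map_closure, Set.image_pair, psiL_T,
    psiL_lowerT]

theorem commute_psi1 {x : Γ} (h1 : Commute x G.s1) (h2 : Commute x G.s2)
    (A : SpecialLinearGroup (Fin 2) ℤ) : Commute x (G.psi1 A) := by
  have : G.psi1.range ≤ Subgroup.centralizer {x} := by
    rw [range_psi1, Subgroup.closure_le]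
    rintro y (rfl | rfl) <;> rw [SetLike.mem_coe, Subgroup.mem_centralizer_singleton_iff]
    · exact h1.symm.eq
    · exact h2.symm.inv_left.eq
  exact (Subgroup.mem_centralizer_singleton_iff.1 (this ⟨A, rfl⟩)).symm

theorem commute_psi1_psi2 (A B : SpecialLinearGroup (Fin 2) ℤ) :
    Commute (G.psi1 A) (G.psi2 B) := by
  have h1 : Commute G.s1 (G.psi2 B) := G.mirror.commute_psi1 G.c15 G.c14 B
  have h2 : Commute G.s2 (G.psi2 B) := G.mirror.commute_psi1 G.c25 G.c24 B
  exact (G.commute_psi1 h1.symm h2.symm A).symm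

theorem wL_psi2 (A : SpecialLinearGroup (Fin 2) ℤ) :
    SemiconjBy G.wL (G.psi2 A) (G.psi1 A) := by
  have h4 : SemiconjBy G.wL G.s4 G.s2 := by rw [wL_eq]; exact G.inv_mul_mul_inv_s4
  have : (MulAut.conj G.wL).toMonoidHom.comp G.psi2 = G.psi1 := by
    refine MonoidHom.eq_of_eqOn_dense closure_T_lowerT ?_
    rintro x (rfl | rfl)
    · simp [psi2_T, psi1_T, G.wL_s5.eq]
    · simp only [MonoidHom.comp_apply, psi2_lowerT, psi1_lowerT]
      simpa using (mul_inv_eq_iff_eq_mul.2 h4.inv_right.eq)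
  rw [SemiconjBy, ← mul_inv_eq_iff_eq_mul, ← this]; simp

theorem w1_sq_s1 : Commute (G.w1 ^ 2) G.s1 := by
  rw [sq]; exact SemiconjBy.mul_left G.w1_s2 G.w1_s1

theorem w1_sq_s5 : Commute (G.w1 ^ 2) G.s5 := Commute.pow_left G.w1_s5 2

theorem y_inv_z : SemiconjBy G.y⁻¹ G.z (G.z * (G.s1 ^ 2)⁻¹) := by
  have h := G.mirror.y'_inv_z
  rwa [mirror_y', mirror_z] at h

theorem y_inv_s5 : SemiconjBy G.y⁻¹ G.s5 (G.s1 * G.z⁻¹ * G.s5) := by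
  have h := G.mirror.y'_inv_s1
  rwa [mirror_y', mirror_z] at h

theorem w1_sq_inv_z : SemiconjBy (G.w1 ^ 2)⁻¹ G.z G.z⁻¹ := by
  rw [w1_sq_inv]; exact G.w1_sq_z

/-- The unipotent radical of the Siegel parabolic subgroup. -/
def siegelRadical : Subgroup Γ := Subgroup.closure {G.s1, G.z, G.s5}

theorem s1_mem_siegelRadical : G.s1 ∈ G.siegelRadical := Subgroup.subset_closure (by simp)

theorem z_mem_siegelRadical : G.z ∈ G.siegelRadical := Subgroup.subset_closure (by simp)

theorem s5_mem_siegelRadical : G.s5 ∈ G.siegelRadical := Subgroup.subset_closure (by simp)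

theorem mirror_siegelRadical : G.mirror.siegelRadical = G.siegelRadical := by
  have : ({G.s5, G.z, G.s1} : Set Γ) = {G.s1, G.z, G.s5} := by grind
  rw [siegelRadical, mirror_z]
  exact congrArg Subgroup.closure this

theorem y_mem_normalizer : G.y ∈ Subgroup.normalizer (G.siegelRadical : Set Γ) := by
  have h1 := G.s1_mem_siegelRadical
  have hz := G.z_mem_siegelRadical
  have h5 := G.s5_mem_siegelRadical
  apply Subgroup.mem_normalizer_closure
  · rintro x (rfl | rfl | rfl)
    · exact ⟨_, h1, G.y_s1⟩
    · exact ⟨_, mul_mem hz (pow_mem h1 2), G.y_z⟩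
    · exact ⟨_, mul_mem (mul_mem hz h1) h5, G.y_s5⟩
  · rintro x (rfl | rfl | rfl)
    · exact ⟨_, h1, G.y_s1.inv_symm_left⟩
    · exact ⟨_, mul_mem hz (inv_mem (pow_mem h1 2)), G.y_inv_z⟩
    · exact ⟨_, mul_mem (mul_mem h1 (inv_mem hz)) h5, G.y_inv_s5⟩

theorem y'_mem_normalizer : G.y' ∈ Subgroup.normalizer (G.siegelRadical : Set Γ) := by
  have h := G.mirror.y_mem_normalizer
  rwa [mirror_y, mirror_siegelRadical] at h

theorem w1_sq_mem_normalizer : G.w1 ^ 2 ∈ Subgroup.normalizer (G.siegelRadical : Set Γ) := by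
  have h1 := G.s1_mem_siegelRadical
  have hz := G.z_mem_siegelRadical
  have h5 := G.s5_mem_siegelRadical
  apply Subgroup.mem_normalizer_closure
  · rintro x (rfl | rfl | rfl)
    · exact ⟨_, h1, G.w1_sq_s1⟩
    · exact ⟨_, inv_mem hz, G.w1_sq_z⟩
    · exact ⟨_, h5, G.w1_sq_s5⟩
  · rintro x (rfl | rfl | rfl)
    · exact ⟨_, h1, G.w1_sq_s1.inv_left⟩
    · exact ⟨_, inv_mem hz, G.w1_sq_inv_z⟩
    · exact ⟨_, h5, G.w1_sq_s5.inv_left⟩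

theorem w1_sq_mem_normalizer_range : G.w1 ^ 2 ∈ Subgroup.normalizer (G.psiL.range : Set Γ) := by
  rw [range_psiL]
  have hy : G.y ∈ Subgroup.closure {G.y, G.y'} := Subgroup.subset_closure (by simp)
  have hy' : G.y' ∈ Subgroup.closure {G.y, G.y'} := Subgroup.subset_closure (by simp)
  apply Subgroup.mem_normalizer_closure
  · rintro x (rfl | rfl)
    · exact ⟨_, inv_mem hy, G.w1_sq_y⟩
    · exact ⟨_, inv_mem hy', G.w1_sq_y'⟩
  · rw [w1_sq_inv]
    rintro x (rfl | rfl)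
    · exact ⟨_, inv_mem hy, G.w1_sq_y⟩
    · exact ⟨_, inv_mem hy', G.w1_sq_y'⟩

/-- The Siegel parabolic subgroup. -/
noncomputable def siegel : Subgroup Γ :=
  (G.psiL.range ⊔ Subgroup.zpowers (G.w1 ^ 2)) ⊔ G.siegelRadical

theorem siegelRadical_le : G.siegelRadical ≤ G.siegel := le_sup_right

theorem psiL_mem_siegel (C : SpecialLinearGroup (Fin 2) ℤ) : G.psiL C ∈ G.siegel :=
  Subgroup.mem_sup_left (Subgroup.mem_sup_left ⟨C, rfl⟩)

theorem w1_sq_mem_siegel : G.w1 ^ 2 ∈ G.siegel :=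
  Subgroup.mem_sup_left (Subgroup.mem_sup_right (Subgroup.mem_zpowers _))

theorem y_mem_siegel : G.y ∈ G.siegel := by rw [← psiL_T]; exact G.psiL_mem_siegel _

theorem y'_mem_siegel : G.y' ∈ G.siegel := by rw [← psiL_lowerT]; exact G.psiL_mem_siegel _

/-- Only one of the two sign changes is built into `siegel`; `wL ^ 2 = w1 ^ 2 * w2 ^ 2` supplies the
other. -/
theorem w2_sq_mem_siegel : G.w2 ^ 2 ∈ G.siegel := by
  have h : G.wL ^ 2 ∈ G.siegel := by
    rw [← inv_inv G.wL, ← psiL_S]; exact pow_mem (inv_mem (G.psiL_mem_siegel _)) 2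
  rw [wL_sq] at h
  exact (Subgroup.mul_mem_cancel_left _ G.w1_sq_mem_siegel).1 h

theorem zpow_w1_sq (n : ℤ) : (G.w1 ^ 2) ^ n = 1 ∨ (G.w1 ^ 2) ^ n = G.w1 ^ 2 := by
  have h : (G.w1 ^ 2) ^ (2 : ℤ) = 1 := by
    rw [zpow_ofNat, ← pow_mul]; exact G.w1_pow_four
  rcases Int.even_or_odd' n with ⟨k, rfl | rfl⟩
  · left; rw [_root_.zpow_mul, h, _root_.one_zpow]
  · right; rw [_root_.zpow_add, _root_.zpow_mul, h, _root_.one_zpow, one_mul, zpow_one]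

/-- Each factor normalises those that follow or precede it as needed, so the joins are products. The
radical stands on the right because it fixes the first basis vector. -/
theorem exists_of_mem_siegel {q : Γ} (hq : q ∈ G.siegel) :
    ∃ C d, (d = 1 ∨ d = G.w1 ^ 2) ∧ ∃ r ∈ G.siegelRadical, q = G.psiL C * d * r := by
  have hd : Subgroup.zpowers (G.w1 ^ 2) ≤ Subgroup.normalizer (G.siegelRadical : Set Γ) := by
    rw [Subgroup.zpowers_le]; exact G.w1_sq_mem_normalizer
  have hL : G.psiL.range ≤ Subgroup.normalizer (G.siegelRadical : Set Γ) := by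
    rw [range_psiL, Subgroup.closure_le]
    rintro x (rfl | rfl)
    · exact G.y_mem_normalizer
    · exact G.y'_mem_normalizer
  have hdL : Subgroup.zpowers (G.w1 ^ 2) ≤ Subgroup.normalizer (G.psiL.range : Set Γ) := by
    rw [Subgroup.zpowers_le]; exact G.w1_sq_mem_normalizer_range
  rw [siegel, ← SetLike.mem_coe,
    Subgroup.coe_mul_of_left_le_normalizer_right _ _ (sup_le hL hd),
    Subgroup.coe_mul_of_right_le_normalizer_left _ _ hdL] at hq
  obtain ⟨_, ⟨_, ⟨C, rfl⟩, _, ⟨n, rfl⟩, rfl⟩, r, hr, rfl⟩ := hq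
  exact ⟨C, _, G.zpow_w1_sq n, r, hr, rfl⟩

/-- The Heisenberg group, the unipotent radical of the stabiliser of a primitive vector. -/
def heisenberg : Subgroup Γ := Subgroup.closure {G.s1, G.z, G.y}

theorem s1_mem_heisenberg : G.s1 ∈ G.heisenberg := Subgroup.subset_closure (by simp)

theorem z_mem_heisenberg : G.z ∈ G.heisenberg := Subgroup.subset_closure (by simp)

theorem y_mem_heisenberg : G.y ∈ G.heisenberg := Subgroup.subset_closure (by simp)

theorem s4_mem_normalizer : G.s4 ∈ Subgroup.normalizer (G.heisenberg : Set Γ) := by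
  have h1 := G.s1_mem_heisenberg
  have hz := G.z_mem_heisenberg
  have hy := G.y_mem_heisenberg
  have c1 : Commute G.s4 G.s1 := G.c14.symm
  apply Subgroup.mem_normalizer_closure
  · rintro x (rfl | rfl | rfl)
    · exact ⟨_, h1, c1⟩
    · exact ⟨_, mul_mem (mul_mem hz hy) h1, G.s4_z⟩
    · exact ⟨_, hy, G.s4_y⟩
  · rintro x (rfl | rfl | rfl)
    · exact ⟨_, h1, c1.inv_left⟩
    · exact ⟨_, mul_mem (mul_mem hz (inv_mem hy)) (inv_mem h1), G.s4_inv_z⟩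
    · exact ⟨_, hy, G.s4_y.inv_left⟩

theorem s5_mem_normalizer : G.s5 ∈ Subgroup.normalizer (G.heisenberg : Set Γ) := by
  have h1 := G.s1_mem_heisenberg
  have hz := G.z_mem_heisenberg
  have hy := G.y_mem_heisenberg
  have c1 : Commute G.s5 G.s1 := G.c15.symm
  apply Subgroup.mem_normalizer_closure
  · rintro x (rfl | rfl | rfl)
    · exact ⟨_, h1, c1⟩
    · exact ⟨_, hz, G.s5_z⟩
    · exact ⟨_, mul_mem (mul_mem hy (inv_mem hz)) h1, G.s5_y⟩
  · rintro x (rfl | rfl | rfl)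
    · exact ⟨_, h1, c1.inv_left⟩
    · exact ⟨_, hz, G.s5_z.inv_left⟩
    · exact ⟨_, mul_mem (mul_mem hy hz) (inv_mem h1), G.s5_inv_y⟩

theorem range_psi2_le_normalizer :
    G.psi2.range ≤ Subgroup.normalizer (G.heisenberg : Set Γ) := by
  rw [range_psi2, Subgroup.closure_le]
  rintro x (rfl | rfl)
  · exact G.s5_mem_normalizer
  · exact inv_mem G.s4_mem_normalizer

/-- This lets `z` pass `psi2 B` and be absorbed into the Siegel factor of an element of the cell. -/
theorem psi2_inv_mul_z_mul_mem (B : SpecialLinearGroup (Fin 2) ℤ) :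
    (G.psi2 B)⁻¹ * G.z * G.psi2 B ∈ G.heisenberg :=
  (Subgroup.mem_normalizer_iff''.1 (G.range_psi2_le_normalizer ⟨B, rfl⟩) _).1 G.z_mem_heisenberg

theorem psi1_inv_mul_z_mul_mem (A : SpecialLinearGroup (Fin 2) ℤ) :
    (G.psi1 A)⁻¹ * G.z * G.psi1 A ∈ G.mirror.heisenberg := by
  have h := G.mirror.psi2_inv_mul_z_mul_mem A
  rwa [mirror_z] at h

theorem heisenberg_le_siegel : G.heisenberg ≤ G.siegel := by
  rw [heisenberg, Subgroup.closure_le]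
  rintro x (rfl | rfl | rfl)
  · exact G.siegelRadical_le G.s1_mem_siegelRadical
  · exact G.siegelRadical_le G.z_mem_siegelRadical
  · exact G.y_mem_siegel

theorem mirror_heisenberg_le_siegel : G.mirror.heisenberg ≤ G.siegel := by
  rw [heisenberg, mirror_z, mirror_y, Subgroup.closure_le]
  rintro x (rfl | rfl | rfl)
  · exact G.siegelRadical_le G.s5_mem_siegelRadical
  · exact G.siegelRadical_le G.z_mem_siegelRadical
  · exact G.y'_mem_siegel

theorem exists_of_mem_heisenberg {x : Γ} (hx : x ∈ G.heisenberg) :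
    ∃ a b c : ℤ, x = G.y ^ a * G.z ^ b * G.s1 ^ c := by
  have hz : Subgroup.zpowers G.z ≤ Subgroup.normalizer (Subgroup.zpowers G.s1 : Set Γ) := by
    rw [Subgroup.zpowers_le, Subgroup.zpowers_eq_closure]
    apply Subgroup.mem_normalizer_closure
    · rintro x rfl
      exact ⟨_, Subgroup.subset_closure rfl, G.s1_z.symm⟩
    · rintro x rfl
      exact ⟨_, Subgroup.subset_closure rfl, G.s1_z.symm.inv_left⟩
  have hy : Subgroup.zpowers G.y ≤
      Subgroup.normalizer ((Subgroup.zpowers G.z ⊔ Subgroup.zpowers G.s1 : Subgroup Γ) : Set Γ) := by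
    rw [Subgroup.zpowers_le, Subgroup.zpowers_eq_closure, Subgroup.zpowers_eq_closure,
      ← Subgroup.closure_union, Set.singleton_union]
    have h1 : G.s1 ∈ Subgroup.closure {G.z, G.s1} := Subgroup.subset_closure (by simp)
    have hz : G.z ∈ Subgroup.closure {G.z, G.s1} := Subgroup.subset_closure (by simp)
    apply Subgroup.mem_normalizer_closure
    · rintro x (rfl | rfl)
      · exact ⟨_, mul_mem hz (pow_mem h1 2), G.y_z⟩
      · exact ⟨_, h1, G.y_s1⟩
    · rintro x (rfl | rfl)
      · exact ⟨_, mul_mem hz (inv_mem (pow_mem h1 2)), G.y_inv_z⟩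
      · exact ⟨_, h1, G.y_s1.inv_symm_left⟩
  have hle : G.heisenberg ≤
      Subgroup.zpowers G.y ⊔ (Subgroup.zpowers G.z ⊔ Subgroup.zpowers G.s1) := by
    rw [heisenberg, Subgroup.closure_le]
    rintro x (rfl | rfl | rfl)
    · exact Subgroup.mem_sup_right (Subgroup.mem_sup_right (Subgroup.mem_zpowers _))
    · exact Subgroup.mem_sup_right (Subgroup.mem_sup_left (Subgroup.mem_zpowers _))
    · exact Subgroup.mem_sup_left (Subgroup.mem_zpowers _)
  have h := hle hx
  rw [← SetLike.mem_coe, Subgroup.coe_mul_of_left_le_normalizer_right _ _ hy,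
    Subgroup.coe_mul_of_left_le_normalizer_right _ _ hz] at h
  obtain ⟨_, ⟨a, rfl⟩, _, ⟨_, ⟨b, rfl⟩, _, ⟨c, rfl⟩, rfl⟩, rfl⟩ := h
  exact ⟨a, b, c, by simp [mul_assoc]⟩

/-- The stabiliser of the first basis vector. -/
noncomputable def klingen : Subgroup Γ := G.psi2.range ⊔ G.heisenberg

theorem psi2_mem_klingen (B : SpecialLinearGroup (Fin 2) ℤ) : G.psi2 B ∈ G.klingen :=
  Subgroup.mem_sup_left ⟨B, rfl⟩

theorem heisenberg_le_klingen : G.heisenberg ≤ G.klingen := le_sup_right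

theorem siegelRadical_le_klingen : G.siegelRadical ≤ G.klingen := by
  rw [siegelRadical, Subgroup.closure_le]
  rintro x (rfl | rfl | rfl)
  · exact G.heisenberg_le_klingen G.s1_mem_heisenberg
  · exact G.heisenberg_le_klingen G.z_mem_heisenberg
  · rw [← psi2_T]; exact G.psi2_mem_klingen _

theorem w2_sq_mem_klingen : G.w2 ^ 2 ∈ G.klingen := by
  rw [← inv_inv G.w2, ← psi2_S]; exact pow_mem (inv_mem (G.psi2_mem_klingen _)) 2

theorem exists_of_mem_klingen {x : Γ} (hx : x ∈ G.klingen) :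
    ∃ B, ∃ a b c : ℤ, x = G.psi2 B * (G.y ^ a * G.z ^ b * G.s1 ^ c) := by
  rw [klingen, ← SetLike.mem_coe,
    Subgroup.coe_mul_of_left_le_normalizer_right _ _ G.range_psi2_le_normalizer] at hx
  obtain ⟨_, ⟨B, rfl⟩, h, hh, rfl⟩ := hx
  obtain ⟨a, b, c, rfl⟩ := G.exists_of_mem_heisenberg hh
  exact ⟨B, a, b, c, rfl⟩

end Sp4System

/-! ### The action on `ℤ⁴` -/

/-- The vector with coordinates `q₁, q₂, p₁, p₂`. -/
def vec4 (a b c d : ℤ) : Fin 2 ⊕ Fin 2 → ℤ := Sum.elim ![a, b] ![c, d]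

theorem vec4_eta (v : Fin 2 ⊕ Fin 2 → ℤ) :
    v = vec4 (v (.inl 0)) (v (.inl 1)) (v (.inr 0)) (v (.inr 1)) := by
  ext i; rcases i with i | i <;> fin_cases i <;> rfl

theorem vec4_inj {a b c d a' b' c' d' : ℤ} :
    vec4 a b c d = vec4 a' b' c' d' ↔ a = a' ∧ b = b' ∧ c = c' ∧ d = d' := by
  refine ⟨fun h => ⟨?_, ?_, ?_, ?_⟩, by rintro ⟨rfl, rfl, rfl, rfl⟩; rfl⟩
  · exact congrFun h (.inl 0)
  · exact congrFun h (.inl 1)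
  · exact congrFun h (.inr 0)
  · exact congrFun h (.inr 1)

theorem fromBlocks_mulVec_vec4 (A B C D : Matrix (Fin 2) (Fin 2) ℤ) (a b c d : ℤ) :
    fromBlocks A B C D *ᵥ vec4 a b c d =
      vec4 (A 0 0 * a + A 0 1 * b + (B 0 0 * c + B 0 1 * d))
        (A 1 0 * a + A 1 1 * b + (B 1 0 * c + B 1 1 * d))
        (C 0 0 * a + C 0 1 * b + (D 0 0 * c + D 0 1 * d))
        (C 1 0 * a + C 1 1 * b + (D 1 0 * c + D 1 1 * d)) := by
  ext i; rcases i with i | i <;> fin_cases i <;>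
    simp [vec4, mulVec, dotProduct, Fintype.sum_sum_type, Fin.sum_univ_two]

/-- A realisation of a system of generators by the standard symplectic matrices. -/
structure Sp4Rep {Γ : Type*} [Group Γ] (G : Sp4System Γ) where
  φ : Γ →* symplecticGroup (Fin 2) ℤ
  map_s1 : (φ G.s1 : Matrix (Fin 2 ⊕ Fin 2) (Fin 2 ⊕ Fin 2) ℤ) = fromBlocks 1 !![1, 0; 0, 0] 0 1
  map_s2 : (φ G.s2 : Matrix (Fin 2 ⊕ Fin 2) (Fin 2 ⊕ Fin 2) ℤ) = fromBlocks 1 0 !![-1, 0; 0, 0] 1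
  map_s3 : (φ G.s3 : Matrix (Fin 2 ⊕ Fin 2) (Fin 2 ⊕ Fin 2) ℤ) =
    fromBlocks 1 !![1, -1; -1, 1] 0 1
  map_s4 : (φ G.s4 : Matrix (Fin 2 ⊕ Fin 2) (Fin 2 ⊕ Fin 2) ℤ) = fromBlocks 1 0 !![0, 0; 0, -1] 1
  map_s5 : (φ G.s5 : Matrix (Fin 2 ⊕ Fin 2) (Fin 2 ⊕ Fin 2) ℤ) = fromBlocks 1 !![0, 0; 0, 1] 0 1
  closure_eq_top : Subgroup.closure {G.s1, G.s2, G.s3, G.s4, G.s5} = ⊤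

namespace Sp4Rep

variable {Γ : Type*} [Group Γ] {G : Sp4System Γ} (R : Sp4Rep G)

/-- The action on column vectors. -/
def act (g : Γ) (v : Fin 2 ⊕ Fin 2 → ℤ) : Fin 2 ⊕ Fin 2 → ℤ :=
  (R.φ g : Matrix (Fin 2 ⊕ Fin 2) (Fin 2 ⊕ Fin 2) ℤ) *ᵥ v

theorem act_mul (g h : Γ) (v : Fin 2 ⊕ Fin 2 → ℤ) : R.act (g * h) v = R.act g (R.act h v) := by
  simp [act, map_mul, mulVec_mulVec]

theorem act_one (v : Fin 2 ⊕ Fin 2 → ℤ) : R.act 1 v = v := by simp [act]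

theorem act_inv_eq {g : Γ} {v w : Fin 2 ⊕ Fin 2 → ℤ} (h : R.act g w = v) : R.act g⁻¹ v = w := by
  rw [← h, ← act_mul, inv_mul_cancel, act_one]

theorem act_s1 (a b c d : ℤ) : R.act G.s1 (vec4 a b c d) = vec4 (a + c) b c d := by
  rw [act, map_s1, fromBlocks_mulVec_vec4]; simp

theorem act_s2 (a b c d : ℤ) : R.act G.s2 (vec4 a b c d) = vec4 a b (c - a) d := by
  rw [act, map_s2, fromBlocks_mulVec_vec4, vec4_inj]; simp; ring

theorem act_s3 (a b c d : ℤ) :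
    R.act G.s3 (vec4 a b c d) = vec4 (a + c - d) (b - c + d) c d := by
  rw [act, map_s3, fromBlocks_mulVec_vec4, vec4_inj]; simp; constructor <;> ring

theorem act_s4 (a b c d : ℤ) : R.act G.s4 (vec4 a b c d) = vec4 a b c (d - b) := by
  rw [act, map_s4, fromBlocks_mulVec_vec4, vec4_inj]; simp; ring

theorem act_s5 (a b c d : ℤ) : R.act G.s5 (vec4 a b c d) = vec4 a (b + d) c d := by
  rw [act, map_s5, fromBlocks_mulVec_vec4]; simp

theorem act_z (a b c d : ℤ) : R.act G.z (vec4 a b c d) = vec4 (a + d) (b + c) c d := by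
  have h3 : R.act G.s3⁻¹ (vec4 a (b + d) c d) = vec4 (a - c + d) (b + c) c d := by
    apply act_inv_eq; rw [act_s3, vec4_inj]; refine ⟨?_, ?_, rfl, rfl⟩ <;> ring
  rw [Sp4System.z, act_mul, act_mul, act_s5, h3, act_s1, vec4_inj]
  refine ⟨?_, rfl, rfl, rfl⟩; ring

theorem act_w1 (a b c d : ℤ) : R.act G.w1 (vec4 a b c d) = vec4 c b (-a) d := by
  rw [Sp4System.w1, act_mul, act_mul, act_s1, act_s2, act_s1, vec4_inj]
  refine ⟨?_, rfl, ?_, rfl⟩ <;> ring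

theorem act_w2 (a b c d : ℤ) : R.act G.w2 (vec4 a b c d) = vec4 a d c (-b) := by
  rw [Sp4System.w2, act_mul, act_mul, act_s5, act_s4, act_s5, vec4_inj]
  refine ⟨rfl, ?_, rfl, ?_⟩ <;> ring

theorem act_w1_inv (a b c d : ℤ) : R.act G.w1⁻¹ (vec4 a b c d) = vec4 (-c) b a d := by
  apply act_inv_eq; rw [act_w1, neg_neg]

theorem act_w2_inv (a b c d : ℤ) : R.act G.w2⁻¹ (vec4 a b c d) = vec4 a (-d) c b := by
  apply act_inv_eq; rw [act_w2, neg_neg]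

theorem act_w1_sq (a b c d : ℤ) : R.act (G.w1 ^ 2) (vec4 a b c d) = vec4 (-a) b (-c) d := by
  rw [sq, act_mul, act_w1, act_w1]

theorem act_y (a b c d : ℤ) : R.act G.y (vec4 a b c d) = vec4 (a + b) b c (d - c) := by
  rw [Sp4System.y, act_mul, act_mul, act_w2_inv, act_z, act_w2, vec4_inj]
  refine ⟨rfl, rfl, rfl, ?_⟩; ring

theorem act_y' (a b c d : ℤ) : R.act G.y' (vec4 a b c d) = vec4 a (b + a) (c - d) d := by
  rw [Sp4System.y', act_mul, act_mul, act_w1_inv, act_z, act_w1, vec4_inj]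
  refine ⟨rfl, rfl, ?_, rfl⟩; ring

/-- A family of transformations that is multiplicative in `SL₂(ℤ)` is determined by its values on
the generators. -/
theorem act_hom_eq (ψ : SpecialLinearGroup (Fin 2) ℤ →* Γ)
    (F : SpecialLinearGroup (Fin 2) ℤ → (Fin 2 ⊕ Fin 2 → ℤ) → Fin 2 ⊕ Fin 2 → ℤ)
    (h1 : ∀ v, F 1 v = v) (hmul : ∀ A B v, F (A * B) v = F A (F B v))
    (hT : ∀ v, R.act (ψ T) v = F T v) (hl : ∀ v, R.act (ψ lowerT) v = F lowerT v)
    (A : SpecialLinearGroup (Fin 2) ℤ) (v : Fin 2 ⊕ Fin 2 → ℤ) : R.act (ψ A) v = F A v := by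
  have hA : A ∈ Subgroup.closure {T, lowerT} := by rw [closure_T_lowerT]; trivial
  have hinv : ∀ B, (∀ v, R.act (ψ B) v = F B v) → ∀ v, R.act (ψ B)⁻¹ v = F B⁻¹ v := by
    intro B hB v
    apply act_inv_eq
    rw [hB, ← hmul, mul_inv_cancel, h1]
  induction hA using Subgroup.closure_induction generalizing v with
  | mem x hx =>
    rcases hx with rfl | rfl
    · exact hT v
    · exact hl v
  | one => rw [map_one, act_one, h1]
  | mul A B _ _ hA hB => rw [map_mul, act_mul, hB, hA, hmul]
  | inv B _ hB => rw [map_inv]; exact hinv B hB v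

theorem act_psi1 (A : SpecialLinearGroup (Fin 2) ℤ) (a b c d : ℤ) :
    R.act (G.psi1 A) (vec4 a b c d) =
      vec4 (A 0 0 * a + A 0 1 * c) b (A 1 0 * a + A 1 1 * c) d := by
  refine R.act_hom_eq G.psi1 (fun A v => vec4 (A 0 0 * v (.inl 0) + A 0 1 * v (.inr 0))
    (v (.inl 1)) (A 1 0 * v (.inl 0) + A 1 1 * v (.inr 0)) (v (.inr 1))) ?_ ?_ ?_ ?_ A _
  · intro v; conv_rhs => rw [vec4_eta v]
    simp
  · intro A B v; rw [vec4_inj]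
    simp [vec4, Matrix.mul_apply, Fin.sum_univ_two]; constructor <;> ring
  · intro v; conv_lhs => rw [vec4_eta v]
    rw [G.psi1_T, act_s1]; simp [coe_T]
  · intro v; conv_lhs => rw [vec4_eta v]
    rw [G.psi1_lowerT]; apply act_inv_eq; rw [act_s2]; simp [coe_lowerT]

theorem act_psi2 (A : SpecialLinearGroup (Fin 2) ℤ) (a b c d : ℤ) :
    R.act (G.psi2 A) (vec4 a b c d) =
      vec4 a (A 0 0 * b + A 0 1 * d) c (A 1 0 * b + A 1 1 * d) := by
  refine R.act_hom_eq G.psi2 (fun A v => vec4 (v (.inl 0))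
    (A 0 0 * v (.inl 1) + A 0 1 * v (.inr 1)) (v (.inr 0))
    (A 1 0 * v (.inl 1) + A 1 1 * v (.inr 1))) ?_ ?_ ?_ ?_ A _
  · intro v; conv_rhs => rw [vec4_eta v]
    simp
  · intro A B v; rw [vec4_inj]
    simp [vec4, Matrix.mul_apply, Fin.sum_univ_two]; constructor <;> ring
  · intro v; conv_lhs => rw [vec4_eta v]
    rw [G.psi2_T, act_s5]; simp [coe_T]
  · intro v; conv_lhs => rw [vec4_eta v]
    rw [G.psi2_lowerT]; apply act_inv_eq; rw [act_s4]; simp [coe_lowerT]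

theorem act_psiL (A : SpecialLinearGroup (Fin 2) ℤ) (a b c d : ℤ) :
    R.act (G.psiL A) (vec4 a b c d) =
      vec4 (A 0 0 * a + A 0 1 * b) (A 1 0 * a + A 1 1 * b)
        (A 1 1 * c - A 1 0 * d) (A 0 0 * d - A 0 1 * c) := by
  refine R.act_hom_eq G.psiL (fun A v => vec4 (A 0 0 * v (.inl 0) + A 0 1 * v (.inl 1))
    (A 1 0 * v (.inl 0) + A 1 1 * v (.inl 1)) (A 1 1 * v (.inr 0) - A 1 0 * v (.inr 1))
    (A 0 0 * v (.inr 1) - A 0 1 * v (.inr 0))) ?_ ?_ ?_ ?_ A _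
  · intro v; conv_rhs => rw [vec4_eta v]
    simp
  · intro A B v; rw [vec4_inj]
    simp [vec4, Matrix.mul_apply, Fin.sum_univ_two]; refine ⟨?_, ?_, ?_, ?_⟩ <;> ring
  · intro v; conv_lhs => rw [vec4_eta v]
    rw [G.psiL_T, act_y]; simp [coe_T]
  · intro v; conv_lhs => rw [vec4_eta v]
    rw [G.psiL_lowerT, act_y', vec4_inj]; simp [coe_lowerT]; ring

theorem act_s1_zpow (n a b c d : ℤ) :
    R.act (G.s1 ^ n) (vec4 a b c d) = vec4 (a + n * c) b c d := by
  rw [← G.psi1_T, ← map_zpow, act_psi1, coe_T_zpow]; simp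

theorem act_s5_zpow (n a b c d : ℤ) :
    R.act (G.s5 ^ n) (vec4 a b c d) = vec4 a (b + n * d) c d := by
  rw [← G.psi2_T, ← map_zpow, act_psi2, coe_T_zpow]; simp

theorem act_y_zpow (n a b c d : ℤ) :
    R.act (G.y ^ n) (vec4 a b c d) = vec4 (a + n * b) b c (d - n * c) := by
  rw [← G.psiL_T, ← map_zpow, act_psiL, coe_T_zpow]; simp

theorem act_z_zpow (n a b c d : ℤ) :
    R.act (G.z ^ n) (vec4 a b c d) = vec4 (a + n * d) (b + n * c) c d := by
  have : G.z = G.w2⁻¹ * G.y * (G.w2⁻¹)⁻¹ := by rw [Sp4System.y]; group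
  rw [this, conj_zpow, inv_inv, act_mul, act_mul, act_w2, act_y_zpow, act_w2_inv, vec4_inj]
  refine ⟨rfl, ?_, rfl, rfl⟩; ring

/-- The first basis vector. -/
def _root_.e4 : Fin 2 ⊕ Fin 2 → ℤ := vec4 1 0 0 0

theorem act_heisenberg (a b c q1 q2 p1 p2 : ℤ) :
    R.act (G.y ^ a * G.z ^ b * G.s1 ^ c) (vec4 q1 q2 p1 p2) =
      vec4 (q1 + c * p1 + b * p2 + a * (q2 + b * p1)) (q2 + b * p1) p1 (p2 - a * p1) := by
  rw [act_mul, act_mul, act_s1_zpow, act_z_zpow, act_y_zpow]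

theorem act_siegelRadical {r : Γ} (hr : r ∈ G.siegelRadical) (a b : ℤ) :
    R.act r (vec4 a b 0 0) = vec4 a b 0 0 := by
  rw [Sp4System.siegelRadical] at hr
  induction hr using Subgroup.closure_induction with
  | mem x hx =>
    rcases hx with rfl | rfl | rfl
    · rw [act_s1, add_zero]
    · rw [act_z, add_zero, add_zero]
    · rw [act_s5, add_zero]
  | one => rw [act_one]
  | mul x y _ _ hx hy => rw [act_mul, hy, hx]
  | inv x _ hx => exact R.act_inv_eq hx

theorem act_klingen {p : Γ} (hp : p ∈ G.klingen) : R.act p e4 = e4 := by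
  obtain ⟨B, a, b, c, rfl⟩ := G.exists_of_mem_klingen hp
  rw [e4, act_mul, act_heisenberg, act_psi2]; simp

theorem eq_one_of_mem_klingen {p : Γ} (hp : p ∈ G.klingen) (h : R.φ p = 1) : p = 1 := by
  obtain ⟨B, a, b, c, rfl⟩ := G.exists_of_mem_klingen hp
  have key : ∀ q1 q2 p1 p2 : ℤ,
      R.act (G.psi2 B * (G.y ^ a * G.z ^ b * G.s1 ^ c)) (vec4 q1 q2 p1 p2) =
        vec4 q1 q2 p1 p2 := by
    intros; rw [act, h]; simp
  simp only [act_mul R (G.psi2 B), act_heisenberg, act_psi2, vec4_inj] at key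
  -- The images of the second and fourth basis vectors give `a`, `b` and the columns of `B`; that of
  -- the third then gives `c`.
  have k0 := key 0 0 1 0
  have k1 := key 0 1 0 0
  have k2 := key 0 0 0 1
  simp at k0 k1 k2
  obtain ⟨rfl, h00, h10⟩ := k1
  obtain ⟨rfl, h01, h11⟩ := k2
  obtain rfl : c = 0 := by simpa using k0.1
  have : B = 1 := by
    ext i j; fin_cases i <;> fin_cases j <;> simp [h00, h10, h01, h11]
  simp [this]

end Sp4Rep

/-- Every vector of `ℤ²` is a multiple of the first column of a matrix in `SL₂(ℤ)`. -/
theorem exists_SL2_mul_eq (a b : ℤ) :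
    ∃ (A : SpecialLinearGroup (Fin 2) ℤ) (m : ℤ), A 0 0 * m = a ∧ A 1 0 * m = b := by
  by_cases h : Int.gcd a b = 0
  · rw [Int.gcd_eq_zero_iff] at h
    exact ⟨1, 0, by simp [h.1], by simp [h.2]⟩
  · obtain ⟨g, a', b', hg, hc, rfl, rfl⟩ := Int.exists_gcd_one' (Nat.pos_of_ne_zero h)
    obtain ⟨A, h0, h1⟩ := (Int.isCoprime_iff_gcd_eq_one.2 hc).exists_SL2_col 0
    exact ⟨A, g, by rw [h0], by rw [h1]⟩

theorem unimodular_of_mulVec_eq {M : Matrix (Fin 2 ⊕ Fin 2) (Fin 2 ⊕ Fin 2) ℤ} {a b c d : ℤ}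
    (h : M *ᵥ vec4 a b c d = e4) :
    ∃ a' b' c' d', a' * a + b' * b + (c' * c + d' * d) = 1 := by
  rw [← fromBlocks_toBlocks M, fromBlocks_mulVec_vec4, e4, vec4_inj] at h
  exact ⟨_, _, _, _, h.1⟩

/-! ### The cell and its evident stability properties -/

namespace Sp4System

variable {Γ : Type*} [Group Γ] (G : Sp4System Γ)

/-- The products of elements of the two long root `SL₂(ℤ)`, of the Siegel parabolic subgroup and
of the stabiliser of the first basis vector. It turns out to be the whole group. -/
def cell : Set Γ :=
  {g | ∃ A B, ∃ q ∈ G.siegel, ∃ p ∈ G.klingen, g = G.psi1 A * G.psi2 B * q * p}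

theorem mem_cell (A B : SpecialLinearGroup (Fin 2) ℤ) {q : Γ} (hq : q ∈ G.siegel) :
    G.psi1 A * G.psi2 B * q ∈ G.cell := ⟨A, B, q, hq, 1, one_mem _, by rw [mul_one]⟩

theorem one_mem_cell : 1 ∈ G.cell := by
  simpa using G.mem_cell 1 1 (one_mem _)

variable {G}

theorem mul_mem_cell {g p : Γ} (hg : g ∈ G.cell) (hp : p ∈ G.klingen) : g * p ∈ G.cell := by
  obtain ⟨A, B, q, hq, p', hp', rfl⟩ := hg
  exact ⟨A, B, q, hq, p' * p, mul_mem hp' hp, by rw [mul_assoc]⟩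

theorem psi1_mul_mem_cell {g : Γ} (hg : g ∈ G.cell) (A : SpecialLinearGroup (Fin 2) ℤ) :
    G.psi1 A * g ∈ G.cell := by
  obtain ⟨A', B, q, hq, p, hp, rfl⟩ := hg
  exact ⟨A * A', B, q, hq, p, hp, by simp only [map_mul, mul_assoc]⟩

theorem psi2_mul_mem_cell {g : Γ} (hg : g ∈ G.cell) (B : SpecialLinearGroup (Fin 2) ℤ) :
    G.psi2 B * g ∈ G.cell := by
  obtain ⟨A, B', q, hq, p, hp, rfl⟩ := hg
  refine ⟨A, B * B', q, hq, p, hp, ?_⟩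
  have := (G.commute_psi1_psi2 A B).eq
  rw [map_mul, ← mul_assoc (G.psi1 A), this]; simp only [mul_assoc]

theorem s1_zpow_mul_mem_cell {g : Γ} (hg : g ∈ G.cell) (n : ℤ) : G.s1 ^ n * g ∈ G.cell := by
  rw [← G.psi1_T, ← map_zpow]; exact psi1_mul_mem_cell hg _

theorem s5_zpow_mul_mem_cell {g : Γ} (hg : g ∈ G.cell) (n : ℤ) : G.s5 ^ n * g ∈ G.cell := by
  rw [← G.psi2_T, ← map_zpow]; exact psi2_mul_mem_cell hg _

theorem s2_zpow_mul_mem_cell {g : Γ} (hg : g ∈ G.cell) (n : ℤ) : G.s2 ^ n * g ∈ G.cell := by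
  rw [← inv_inv G.s2, ← G.psi1_lowerT, ← map_inv, ← map_zpow]; exact psi1_mul_mem_cell hg _

theorem s4_zpow_mul_mem_cell {g : Γ} (hg : g ∈ G.cell) (n : ℤ) : G.s4 ^ n * g ∈ G.cell := by
  rw [← inv_inv G.s4, ← G.psi2_lowerT, ← map_inv, ← map_zpow]; exact psi2_mul_mem_cell hg _

theorem w1_zpow_mul_mem_cell {g : Γ} (hg : g ∈ G.cell) (n : ℤ) : G.w1 ^ n * g ∈ G.cell := by
  rw [← inv_inv G.w1, ← G.psi1_S, ← map_inv, ← map_zpow]; exact psi1_mul_mem_cell hg _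

theorem w1_sq_mul_mem_cell {g : Γ} (hg : g ∈ G.cell) : G.w1 ^ 2 * g ∈ G.cell := by
  rw [← zpow_natCast]; exact w1_zpow_mul_mem_cell hg _

theorem w2_zpow_mul_mem_cell {g : Γ} (hg : g ∈ G.cell) (n : ℤ) : G.w2 ^ n * g ∈ G.cell := by
  rw [← inv_inv G.w2, ← G.psi2_S, ← map_inv, ← map_zpow]; exact psi2_mul_mem_cell hg _

theorem psi1_mem_siegel {A : SpecialLinearGroup (Fin 2) ℤ} (h : A 1 0 = 0) :
    G.psi1 A ∈ G.siegel := by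
  have h1 := G.siegelRadical_le G.s1_mem_siegelRadical
  obtain ⟨n, rfl | rfl⟩ := exists_eq_T_zpow_or h
  · rw [map_zpow, psi1_T]; exact zpow_mem h1 _
  · rw [map_mul, map_zpow, psi1_T, map_pow, psi1_S, inv_pow]
    exact mul_mem (zpow_mem h1 _) (inv_mem G.w1_sq_mem_siegel)

theorem psi2_mem_siegel {A : SpecialLinearGroup (Fin 2) ℤ} (h : A 1 0 = 0) :
    G.psi2 A ∈ G.siegel := by
  have h5 := G.siegelRadical_le G.s5_mem_siegelRadical
  obtain ⟨n, rfl | rfl⟩ := exists_eq_T_zpow_or h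
  · rw [map_zpow, psi2_T]; exact zpow_mem h5 _
  · rw [map_mul, map_zpow, psi2_T, map_pow, psi2_S, inv_pow]
    exact mul_mem (zpow_mem h5 _) (inv_mem G.w2_sq_mem_siegel)

end Sp4System

/-! ### Comparison of first columns, and the descent for `z` -/

namespace Sp4Rep

variable {Γ : Type*} [Group Γ] {G : Sp4System Γ} (R : Sp4Rep G)

open Sp4System

theorem act_siegel {q : Γ} (hq : q ∈ G.siegel) :
    ∃ m n : ℤ, IsCoprime m n ∧ R.act q e4 = vec4 m n 0 0 := by
  obtain ⟨C, d, hd, r, hr, rfl⟩ := G.exists_of_mem_siegel hq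
  have hC := C.det_coe
  rw [det_fin_two] at hC
  have hc : IsCoprime (C 0 0) (C 1 0) := ⟨C 1 1, -C 0 1, by linarith⟩
  rcases hd with rfl | rfl
  · refine ⟨C 0 0, C 1 0, hc, ?_⟩
    rw [act_mul, e4, R.act_siegelRadical hr, mul_one, act_psiL]; simp
  · refine ⟨-C 0 0, -C 1 0, hc.neg_neg, ?_⟩
    rw [act_mul, e4, R.act_siegelRadical hr, act_mul, act_w1_sq, act_psiL]; simp

theorem mem_klingen_of_mem_siegel {q : Γ} (hq : q ∈ G.siegel) (h : R.act q e4 = e4) :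
    q ∈ G.klingen := by
  obtain ⟨C, d, hd, r, hr, rfl⟩ := G.exists_of_mem_siegel hq
  have hy := G.heisenberg_le_klingen G.y_mem_heisenberg
  refine mul_mem ?_ (G.siegelRadical_le_klingen hr)
  rw [act_mul, e4, R.act_siegelRadical hr] at h
  rcases hd with rfl | rfl
  · rw [mul_one, act_psiL, vec4_inj] at h
    simp only [mul_one, mul_zero, add_zero] at h
    obtain ⟨n, rfl⟩ := exists_eq_T_zpow h.1 h.2.1
    rw [mul_one, map_zpow, psiL_T]; exact zpow_mem hy _
  -- Here `C` sends the first basis vector of `ℤ²` to its negative, so `C * S ^ 2` is a power of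
  -- `T`. Then `wL_sq` leaves a power of `y` times `w2 ^ 2`, which is in `klingen`.
  · rw [act_mul, act_w1_sq, act_psiL, vec4_inj] at h
    obtain ⟨n, hn⟩ := exists_eq_T_zpow (A := C * S ^ 2) (by simpa [S_sq] using h.1)
      (by simpa [S_sq] using h.2.1)
    rw [← eq_mul_inv_iff_mul_eq] at hn
    rw [hn, map_mul, map_zpow, psiL_T, map_inv, map_pow, psiL_S, inv_pow, inv_inv, wL_sq,
      (G.w1_w2.pow_pow 2 2).eq, mul_assoc, mul_assoc, ← pow_add, w1_pow_four, mul_one]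
    exact mul_mem (zpow_mem hy _) G.w2_sq_mem_klingen

theorem exists_w1_sq_mul_mem_klingen {q : Γ} (hq : q ∈ G.siegel) {m : ℤ}
    (h : R.act q e4 = vec4 m 0 0 0) (hm : IsUnit m) :
    ∃ d p, (∀ B, Commute d (G.psi2 B)) ∧ p ∈ G.klingen ∧ q = d * p := by
  rcases Int.isUnit_iff.1 hm with rfl | rfl
  · exact ⟨1, q, fun _ => Commute.one_left _, R.mem_klingen_of_mem_siegel hq h, by rw [one_mul]⟩
  · refine ⟨(G.w1 ^ 2)⁻¹, G.w1 ^ 2 * q, fun B => ?_, ?_, by rw [inv_mul_cancel_left]⟩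
    · have := G.commute_psi1_psi2 (S ^ 2) B
      rwa [map_pow, psi1_S, inv_pow] at this
    · refine R.mem_klingen_of_mem_siegel (mul_mem G.w1_sq_mem_siegel hq) ?_
      rw [act_mul, h, act_w1_sq]; rfl

theorem inv_mul_mem_klingen_of_siegel {q q' : Γ} (hq : q ∈ G.siegel) (hq' : q' ∈ G.siegel)
    (h : R.act q e4 = R.act q' e4) : q⁻¹ * q' ∈ G.klingen := by
  refine R.mem_klingen_of_mem_siegel (mul_mem (inv_mem hq) hq') ?_
  rw [act_mul, ← h]; exact R.act_inv_eq rfl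

/-- With `q` having first column `(m, n, 0, 0)`, equality of columns gives `A 1 0 * m = 0` and `B 1
0 * n = 0`. If `m` and `n` are both nonzero, `A` and `B` are upper triangular and everything lies in
`siegel`. If one vanishes the other is a unit, and the remaining factor from `SL₂(ℤ)` is conjugated
into `klingen`. -/
theorem inv_mul_mem_klingen_aux {q q' : Γ} (hq : q ∈ G.siegel) (hq' : q' ∈ G.siegel)
    (A B : SpecialLinearGroup (Fin 2) ℤ)
    (h : R.act (G.psi1 A * G.psi2 B * q) e4 = R.act q' e4) :
    (G.psi1 A * G.psi2 B * q)⁻¹ * q' ∈ G.klingen := by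
  obtain ⟨m, n, hmn, hv⟩ := R.act_siegel hq
  obtain ⟨m', n', -, hv'⟩ := R.act_siegel hq'
  have h' := h
  rw [act_mul, act_mul, hv, hv', act_psi2, act_psi1, vec4_inj] at h'
  simp only [mul_zero, add_zero, mul_eq_zero] at h'
  obtain ⟨-, -, hA, hB⟩ := h'
  rcases eq_or_ne m 0 with rfl | hm
  · have hn : IsUnit n := isCoprime_zero_left.1 hmn
    have hB := psi2_mem_siegel (G := G) (hB.resolve_right hn.ne_zero)
    set r := G.psi2 B * q with hr
    have hrs : r ∈ G.siegel := mul_mem hB hq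
    obtain ⟨k, l, hkl, hrv⟩ := R.act_siegel hrs
    have hk : k = 0 := by
      rw [hr, act_mul, hv, act_psi2, vec4_inj] at hrv
      exact hrv.1.symm
    subst hk
    have hl : IsUnit l := isCoprime_zero_left.1 hkl
    have h1 : r⁻¹ * q' ∈ G.klingen := by
      refine R.inv_mul_mem_klingen_of_siegel hrs hq' ?_
      rw [← h, mul_assoc, R.act_mul (G.psi1 A) (G.psi2 B * q), ← hr, hrv, act_psi1]; simp
    -- The column of `r` lies along the second coordinate; `psiL S = wL⁻¹` turns it to the first.
    -- Conjugation by `wL` then exchanges `psi1 A` for `psi2 A`, which is in `klingen`.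
    obtain ⟨d, p, hd, hp, e⟩ := R.exists_w1_sq_mul_mem_klingen (m := -l)
      (mul_mem (G.psiL_mem_siegel S) hrs)
      (by rw [act_mul, hrv, act_psiL]; simp [coe_S]) hl.neg
    have e2 : r = G.wL * (d * p) := by rw [← e, psiL_S, mul_inv_cancel_left]
    have h2 : r⁻¹ * (G.psi1 A)⁻¹ * r = p⁻¹ * (G.psi2 A)⁻¹ * p := by
      have hw := (G.wL_psi2 A).inv_right.eq
      calc r⁻¹ * (G.psi1 A)⁻¹ * r = p⁻¹ * d⁻¹ * G.wL⁻¹ * ((G.psi1 A)⁻¹ * G.wL) * d * p := by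
            rw [e2]; group
        _ = p⁻¹ * (d⁻¹ * (G.psi2 A)⁻¹) * d * p := by rw [← hw]; group
        _ = _ := by rw [((hd A).inv_inv).eq]; group
    have h3 : (G.psi1 A * G.psi2 B * q)⁻¹ * q' = (r⁻¹ * (G.psi1 A)⁻¹ * r) * (r⁻¹ * q') := by
      rw [hr]; group
    rw [h3, h2]
    exact mul_mem (mul_mem (mul_mem (inv_mem hp) (inv_mem (G.psi2_mem_klingen A))) hp) h1
  · have hA := psi1_mem_siegel (G := G) (hA.resolve_right hm)
    rcases eq_or_ne n 0 with rfl | hn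
    · have hm' : IsUnit m := isCoprime_zero_right.1 hmn
      set r := G.psi1 A * q with hr
      have hrs : r ∈ G.siegel := mul_mem hA hq
      obtain ⟨k, l, hkl, hrv⟩ := R.act_siegel hrs
      have hl : l = 0 := by
        rw [hr, act_mul, hv, act_psi1, vec4_inj] at hrv
        exact hrv.2.1.symm
      subst hl
      have hk : IsUnit k := isCoprime_zero_right.1 hkl
      have e1 : G.psi1 A * G.psi2 B * q = G.psi2 B * r := by
        rw [(G.commute_psi1_psi2 A B).eq, mul_assoc]
      rw [e1] at h ⊢
      have h1 : r⁻¹ * q' ∈ G.klingen := by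
        refine R.inv_mul_mem_klingen_of_siegel hrs hq' ?_
        rw [← h, R.act_mul (G.psi2 B) r, hrv, act_psi2]; simp
      obtain ⟨d, p, hd, hp, e⟩ := R.exists_w1_sq_mul_mem_klingen hrs hrv hk
      have h2 : r⁻¹ * (G.psi2 B)⁻¹ * r = p⁻¹ * (G.psi2 B)⁻¹ * p := by
        rw [e]
        calc _ = p⁻¹ * (d⁻¹ * (G.psi2 B)⁻¹) * d * p := by group
          _ = _ := by rw [((hd B).inv_inv).eq]; group
      have h3 : (G.psi2 B * r)⁻¹ * q' = (r⁻¹ * (G.psi2 B)⁻¹ * r) * (r⁻¹ * q') := by group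
      rw [h3, h2]
      exact mul_mem (mul_mem (mul_mem (inv_mem hp) (inv_mem (G.psi2_mem_klingen B))) hp) h1
    · have hB := psi2_mem_siegel (G := G) (hB.resolve_right hn)
      exact R.inv_mul_mem_klingen_of_siegel (mul_mem (mul_mem hA hB) hq) hq' h

/-- Two elements of the cell with the same first column differ by an element of the stabiliser. -/
theorem inv_mul_mem_klingen {g g' : Γ} (hg : g ∈ G.cell) (hg' : g' ∈ G.cell)
    (h : R.act g e4 = R.act g' e4) : g⁻¹ * g' ∈ G.klingen := by
  obtain ⟨A, B, q, hq, p, hp, rfl⟩ := hg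
  obtain ⟨A', B', q', hq', p', hp', rfl⟩ := hg'
  have e : (G.psi1 A' * G.psi2 B')⁻¹ * (G.psi1 A * G.psi2 B) =
      G.psi1 (A'⁻¹ * A) * G.psi2 (B'⁻¹ * B) := by
    have := (G.commute_psi1_psi2 (A'⁻¹ * A) B'⁻¹).eq
    calc _ = (G.psi2 B')⁻¹ * ((G.psi1 A')⁻¹ * G.psi1 A) * G.psi2 B := by group
      _ = G.psi2 B'⁻¹ * G.psi1 (A'⁻¹ * A) * G.psi2 B := by simp only [map_mul, map_inv]
      _ = _ := by rw [← this, map_mul G.psi2, mul_assoc]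
  have h1 : R.act (G.psi1 (A'⁻¹ * A) * G.psi2 (B'⁻¹ * B) * q) e4 = R.act q' e4 := by
    rw [act_mul _ _ p, act_mul _ _ p', R.act_klingen hp, R.act_klingen hp'] at h
    rw [← e, mul_assoc, act_mul, h, act_mul]
    exact R.act_inv_eq rfl
  have h2 := R.inv_mul_mem_klingen_aux hq hq' _ _ h1
  rw [← e] at h2
  have h3 : (G.psi1 A * G.psi2 B * q * p)⁻¹ * (G.psi1 A' * G.psi2 B' * q' * p') =
      p⁻¹ * (((G.psi1 A' * G.psi2 B')⁻¹ * (G.psi1 A * G.psi2 B) * q)⁻¹ * q') * p' := by group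
  rw [h3]
  exact mul_mem (mul_mem (inv_mem hp) h2) hp'

/-- The cell acts transitively on unimodular vectors. -/
theorem exists_mem_cell_act_eq {a b c d a' b' c' d' : ℤ}
    (h : a' * a + b' * b + (c' * c + d' * d) = 1) :
    ∃ g ∈ G.cell, R.act g e4 = vec4 a b c d := by
  -- Reduce each plane to its first axis, leaving lengths `m` and `n`. Unimodularity makes them
  -- coprime, so `(m, n)` is a column of some `C` in `SL₂(ℤ)`.
  obtain ⟨A, m, rfl, rfl⟩ := exists_SL2_mul_eq a c
  obtain ⟨B, n, rfl, rfl⟩ := exists_SL2_mul_eq b d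
  have hmn : IsCoprime m n :=
    ⟨a' * A 0 0 + c' * A 1 0, b' * B 0 0 + d' * B 1 0, by linear_combination h⟩
  obtain ⟨C, h0, h1⟩ := hmn.exists_SL2_col 0
  refine ⟨_, G.mem_cell A B (G.psiL_mem_siegel C), ?_⟩
  rw [act_mul, act_mul, e4, act_psiL, act_psi2, act_psi1]; simp [h0, h1]

theorem unimodular_act {g : Γ} {a b c d : ℤ} (h : R.act g e4 = vec4 a b c d) :
    ∃ a' b' c' d', a' * a + b' * b + (c' * c + d' * d) = 1 :=
  unimodular_of_mulVec_eq (R.act_inv_eq h)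

/-- Since the third coordinate vanishes, `g` may be replaced, up to `klingen`, by `psi2 B * psiL C`
with no factor from `psi1`. Then `z` passes `psi2 B` into the Heisenberg group, hence into `siegel`.
-/
theorem z_mul_mem_cell_of_left {g : Γ} (hg : g ∈ G.cell) {a b d : ℤ}
    (h : R.act g e4 = vec4 a b 0 d) : G.z * g ∈ G.cell := by
  obtain ⟨a', b', c', d', hu⟩ := R.unimodular_act h
  obtain ⟨B, n, rfl, rfl⟩ := exists_SL2_mul_eq b d
  have hmn : IsCoprime a n := ⟨a', b' * B 0 0 + d' * B 1 0, by linear_combination hu⟩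
  obtain ⟨C, h0, h1⟩ := hmn.exists_SL2_col 0
  have hC := G.psiL_mem_siegel C
  have hp := R.inv_mul_mem_klingen (G.mem_cell 1 B hC) hg (by
    rw [h, act_mul, act_mul, e4, act_psiL, act_psi2, act_psi1]; simp [h0, h1])
  have e : G.z * g = G.psi1 1 * G.psi2 B * (((G.psi2 B)⁻¹ * G.z * G.psi2 B) * G.psiL C) *
      ((G.psi1 1 * G.psi2 B * G.psiL C)⁻¹ * g) := by
    rw [map_one]; group
  rw [e]
  exact mul_mem_cell (G.mem_cell 1 B
    (mul_mem (G.heisenberg_le_siegel (G.psi2_inv_mul_z_mul_mem B)) hC)) hp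

theorem z_mul_mem_cell_of_right {g : Γ} (hg : g ∈ G.cell) {a b c : ℤ}
    (h : R.act g e4 = vec4 a b c 0) : G.z * g ∈ G.cell := by
  obtain ⟨a', b', c', d', hu⟩ := R.unimodular_act h
  obtain ⟨A, m, rfl, rfl⟩ := exists_SL2_mul_eq a c
  have hmn : IsCoprime m b := ⟨a' * A 0 0 + c' * A 1 0, b', by linear_combination hu⟩
  obtain ⟨C, h0, h1⟩ := hmn.exists_SL2_col 0
  have hC := G.psiL_mem_siegel C
  have hp := R.inv_mul_mem_klingen (G.mem_cell A 1 hC) hg (by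
    rw [h, act_mul, act_mul, e4, act_psiL, act_psi2, act_psi1]; simp [h0, h1])
  have e : G.z * g = G.psi1 A * G.psi2 1 * (((G.psi1 A)⁻¹ * G.z * G.psi1 A) * G.psiL C) *
      ((G.psi1 A * G.psi2 1 * G.psiL C)⁻¹ * g) := by
    rw [map_one]; group
  rw [e]
  exact mul_mem_cell (G.mem_cell A 1
    (mul_mem (G.mirror_heisenberg_le_siegel (G.psi1_inv_mul_z_mul_mem A)) hC)) hp

/-- A shift of `q` by a multiple of `p` makes it small, with the sign opposite to `p`. -/
theorem _root_.exists_shift_natAbs_lt {p p' : ℤ} (q : ℤ) (hp : p ≠ 0)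
    (h : p' < 0 ∧ 0 < p ∨ 0 < p' ∧ p < 0) (hle : p'.natAbs ≤ p.natAbs) :
    ∃ n : ℤ, (-(q + n * p)).natAbs < p.natAbs ∧ (p + (q + n * p) + p').natAbs < p.natAbs := by
  rcases h with ⟨h1, h2⟩ | ⟨h1, h2⟩
  · have e := Int.emod_add_mul_ediv (-q) p
    have := Int.emod_nonneg (-q) hp
    have := Int.emod_lt_of_pos (-q) h2
    refine ⟨(-q) / p, ?_⟩
    have e' : q + (-q) / p * p = -((-q) % p) := by linarith [mul_comm ((-q) / p) p]
    rw [e']; omega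
  · have e := Int.emod_add_mul_ediv q p
    have := Int.emod_nonneg q hp
    have := Int.emod_lt_abs q hp
    rw [abs_of_neg h2] at this
    refine ⟨-(q / p), ?_⟩
    have e' : q + -(q / p) * p = q % p := by linarith [mul_comm (q / p) p]
    rw [e']; omega

/-- The formula `s2_inv_z` gives `z = s2 * z * w1⁻¹ * z * w1 * s5⁻¹ * s2⁻¹`. Once a power of `s1`,
which commutes with `z`, has adjusted `a` modulo `c`, both occurrences of `z` on the right meet
columns with a smaller third coordinate and the same fourth. Opposite signs of `c` and `d` keep `c +
a + d` small. -/
theorem z_mul_mem_cell_of_left_le {g : Γ} (hg : g ∈ G.cell) {a b c d : ℤ}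
    (h : R.act g e4 = vec4 a b c d) (hc : c ≠ 0) (hs : d < 0 ∧ 0 < c ∨ 0 < d ∧ c < 0)
    (hle : d.natAbs ≤ c.natAbs)
    (ih : ∀ g ∈ G.cell, ∀ a' b' c', c'.natAbs < c.natAbs →
      R.act g e4 = vec4 a' b' c' d → G.z * g ∈ G.cell) : G.z * g ∈ G.cell := by
  obtain ⟨n, h1, h2⟩ := exists_shift_natAbs_lt a hc hs hle
  have hg1 := s1_zpow_mul_mem_cell hg n
  have v1 : R.act (G.s1 ^ n * g) e4 = vec4 (a + n * c) b c d := by rw [act_mul, h, act_s1_zpow]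
  set g1 := G.s1 ^ n * g
  set a1 := a + n * c
  have e1 : G.z * g = G.s1 ^ (-n) * (G.z * g1) := by
    have := (G.s1_z.zpow_left n).eq
    rw [← mul_assoc G.z, ← this]; group
  have hg2 : G.w1 * (G.s5⁻¹ * (G.s2⁻¹ * g1)) ∈ G.cell := by
    simpa using w1_zpow_mul_mem_cell (s5_zpow_mul_mem_cell (s2_zpow_mul_mem_cell hg1 (-1)) (-1)) 1
  have v2 : R.act (G.w1 * (G.s5⁻¹ * (G.s2⁻¹ * g1))) e4 = vec4 (c + a1) (b - d) (-a1) d := by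
    have hs2 : R.act G.s2⁻¹ (vec4 a1 b c d) = vec4 a1 b (c + a1) d := by
      apply act_inv_eq; rw [act_s2, add_sub_cancel_right]
    have hs5 : R.act G.s5⁻¹ (vec4 a1 b (c + a1) d) = vec4 a1 (b - d) (c + a1) d := by
      apply act_inv_eq; rw [act_s5, sub_add_cancel]
    rw [act_mul, act_mul, act_mul, v1, hs2, hs5, act_w1]
  set g2 := G.w1 * (G.s5⁻¹ * (G.s2⁻¹ * g1)) with hg2'
  have hz2 := ih g2 hg2 _ _ _ h1 v2
  have hg3 : G.w1⁻¹ * (G.z * g2) ∈ G.cell := by simpa using w1_zpow_mul_mem_cell hz2 (-1)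
  have v3 : R.act (G.w1⁻¹ * (G.z * g2)) e4 = vec4 a1 (b - d - a1) (c + a1 + d) d := by
    rw [act_mul, act_mul, v2, act_z, act_w1_inv, neg_neg, ← sub_eq_add_neg]
  have hz3 := ih _ hg3 _ _ _ h2 v3
  have e2 : G.z * g1 = G.s2 * (G.z * (G.w1⁻¹ * (G.z * g2))) := by
    have hA := G.s2_inv_z.eq
    have hy : G.w1⁻¹ * G.z = G.y'⁻¹ * G.w1⁻¹ := by
      have := G.w1_y'.inv_right.inv_symm_left.eq
      rwa [inv_inv] at this
    rw [← inv_mul_eq_iff_eq_mul, ← mul_assoc, hA, hg2', ← mul_assoc G.w1⁻¹, hy]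
    simp only [mul_assoc, inv_mul_cancel_left]
  rw [e1, e2]
  exact s1_zpow_mul_mem_cell (by simpa using s2_zpow_mul_mem_cell hz3 1) _

theorem z_mul_mem_cell_of_right_le {g : Γ} (hg : g ∈ G.cell) {a b c d : ℤ}
    (h : R.act g e4 = vec4 a b c d) (hd : d ≠ 0) (hs : c < 0 ∧ 0 < d ∨ 0 < c ∧ d < 0)
    (hle : c.natAbs ≤ d.natAbs)
    (ih : ∀ g ∈ G.cell, ∀ a' b' d', d'.natAbs < d.natAbs →
      R.act g e4 = vec4 a' b' c d' → G.z * g ∈ G.cell) : G.z * g ∈ G.cell := by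
  obtain ⟨n, h1, h2⟩ := exists_shift_natAbs_lt b hd hs hle
  have hg1 := s5_zpow_mul_mem_cell hg n
  have v1 : R.act (G.s5 ^ n * g) e4 = vec4 a (b + n * d) c d := by rw [act_mul, h, act_s5_zpow]
  set g1 := G.s5 ^ n * g
  set b1 := b + n * d
  have e1 : G.z * g = G.s5 ^ (-n) * (G.z * g1) := by
    have := (G.s5_z.zpow_left n).eq
    rw [← mul_assoc G.z, ← this]; group
  have hg2 : G.w2 * (G.s1⁻¹ * (G.s4⁻¹ * g1)) ∈ G.cell := by
    simpa using w2_zpow_mul_mem_cell (s1_zpow_mul_mem_cell (s4_zpow_mul_mem_cell hg1 (-1)) (-1)) 1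
  have v2 : R.act (G.w2 * (G.s1⁻¹ * (G.s4⁻¹ * g1))) e4 = vec4 (a - c) (d + b1) c (-b1) := by
    have hs4 : R.act G.s4⁻¹ (vec4 a b1 c d) = vec4 a b1 c (d + b1) := by
      apply act_inv_eq; rw [act_s4, add_sub_cancel_right]
    have hs1 : R.act G.s1⁻¹ (vec4 a b1 c (d + b1)) = vec4 (a - c) b1 c (d + b1) := by
      apply act_inv_eq; rw [act_s1, sub_add_cancel]
    rw [act_mul, act_mul, act_mul, v1, hs4, hs1, act_w2]
  set g2 := G.w2 * (G.s1⁻¹ * (G.s4⁻¹ * g1)) with hg2'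
  have hz2 := ih g2 hg2 _ _ _ h1 v2
  have hg3 : G.w2⁻¹ * (G.z * g2) ∈ G.cell := by simpa using w2_zpow_mul_mem_cell hz2 (-1)
  have v3 : R.act (G.w2⁻¹ * (G.z * g2)) e4 = vec4 (a - c - b1) b1 c (d + b1 + c) := by
    rw [act_mul, act_mul, v2, act_z, act_w2_inv, neg_neg, ← sub_eq_add_neg]
  have hz3 := ih _ hg3 _ _ _ h2 v3
  have e2 : G.z * g1 = G.s4 * (G.z * (G.w2⁻¹ * (G.z * g2))) := by
    have hA := G.s4_inv_z.eq
    have hy : G.w2⁻¹ * G.z = G.y⁻¹ * G.w2⁻¹ := by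
      have := G.w2_y.inv_right.inv_symm_left.eq
      rwa [inv_inv] at this
    rw [← inv_mul_eq_iff_eq_mul, ← mul_assoc, hA, hg2', ← mul_assoc G.w2⁻¹, hy]
    simp only [mul_assoc, inv_mul_cancel_left]
  rw [e1, e2]
  exact s5_zpow_mul_mem_cell (by simpa using s4_zpow_mul_mem_cell hz3 1) _

/-- Induction on `|c| + |d|`. The opposite-sign case comes first, over the whole current level,
because the same-sign case reduces to it without lowering the level. -/
theorem z_mul_mem_cell_aux (n : ℕ) : ∀ g ∈ G.cell, ∀ a b c d, c.natAbs + d.natAbs ≤ n →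
    R.act g e4 = vec4 a b c d → G.z * g ∈ G.cell := by
  induction n with
  | zero =>
    intro g hg a b c d hn h
    obtain rfl : c = 0 := by omega
    exact R.z_mul_mem_cell_of_left hg h
  | succ n ih =>
    have opp : ∀ g ∈ G.cell, ∀ a b c d, c.natAbs + d.natAbs ≤ n + 1 →
        (c < 0 ∧ 0 < d ∨ 0 < c ∧ d < 0) → R.act g e4 = vec4 a b c d → G.z * g ∈ G.cell := by
      intro g hg a b c d hn hs h
      rcases le_total d.natAbs c.natAbs with hle | hle
      · refine R.z_mul_mem_cell_of_left_le hg h (by omega) (by omega) hle ?_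
        intro g' hg' a' b' c' hc' h'
        exact ih g' hg' a' b' c' d (by omega) h'
      · refine R.z_mul_mem_cell_of_right_le hg h (by omega) (by omega) hle ?_
        intro g' hg' a' b' d' hd' h'
        exact ih g' hg' a' b' c d' (by omega) h'
    intro g hg a b c d hn h
    rcases eq_or_ne c 0 with rfl | hc
    · exact R.z_mul_mem_cell_of_left hg h
    rcases eq_or_ne d 0 with rfl | hd
    · exact R.z_mul_mem_cell_of_right hg h
    by_cases hs : c < 0 ∧ 0 < d ∨ 0 < c ∧ d < 0
    · exact opp g hg a b c d hn hs h
    -- if `c` and `d` have the same sign, use that `w1 ^ 2` conjugates `z` to its inverse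
    have hv : R.act (G.z * g) e4 = vec4 (a + d) (b + c) c d := by rw [act_mul, h, act_z]
    -- Choose `g1` in the cell with the column expected of `z * g`. After `w1 ^ 2` its lower signs
    -- are opposite, so `z⁻¹ * g1` is in the cell; having the column of `g`, it differs from `g` by
    -- `klingen`.
    obtain ⟨a', b', c', d', hu⟩ := R.unimodular_act hv
    obtain ⟨g1, hg1, v1⟩ := R.exists_mem_cell_act_eq hu
    have hg2 : G.w1 ^ 2 * g1 ∈ G.cell := w1_sq_mul_mem_cell hg1
    have hz2 := opp _ hg2 (-(a + d)) (b + c) (-c) d (by omega) (by omega)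
      (by rw [act_mul, v1, act_w1_sq])
    have hz3 : G.z⁻¹ * g1 ∈ G.cell := by
      have h' : G.w1 ^ 2 * (G.z * (G.w1 ^ 2 * g1)) ∈ G.cell := w1_sq_mul_mem_cell hz2
      rwa [← mul_assoc, G.w1_sq_z.eq, mul_assoc, ← mul_assoc (G.w1 ^ 2), ← pow_add,
        w1_pow_four, one_mul] at h'
    have hp := R.inv_mul_mem_klingen hz3 hg (by
      rw [h, act_mul, v1, ← hv, ← act_mul, inv_mul_cancel_left, h])
    have := mul_mem_cell hg1 hp
    rwa [show g1 * ((G.z⁻¹ * g1)⁻¹ * g) = G.z * g by group] at this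

theorem z_mul_mem_cell (R : Sp4Rep G) {g : Γ} (hg : g ∈ G.cell) : G.z * g ∈ G.cell :=
  R.z_mul_mem_cell_aux _ g hg _ _ _ _ le_rfl (vec4_eta _)

theorem z_inv_mul_mem_cell (R : Sp4Rep G) {g : Γ} (hg : g ∈ G.cell) : G.z⁻¹ * g ∈ G.cell := by
  have h : G.w1 ^ 2 * (G.z * (G.w1 ^ 2 * g)) ∈ G.cell :=
    w1_sq_mul_mem_cell (R.z_mul_mem_cell (w1_sq_mul_mem_cell hg))
  rwa [← mul_assoc, G.w1_sq_z.eq, mul_assoc, ← mul_assoc (G.w1 ^ 2), ← pow_add,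
    w1_pow_four, one_mul] at h

theorem mem_cell (R : Sp4Rep G) (g : Γ) : g ∈ G.cell := by
  have hg : g ∈ Subgroup.closure {G.s1, G.s2, G.s3, G.s4, G.s5} := by
    rw [R.closure_eq_top]; trivial
  -- All generators but `s3` lie in the images of `psi1` and `psi2`; for `s3` the descent for `z` is
  -- needed.
  have e3 : G.s3 = G.s5 * G.z⁻¹ * G.s1 := by rw [Sp4System.z]; group
  induction hg using Subgroup.closure_induction_left with
  | one => exact G.one_mem_cell
  | mul_left x hx y _ ih =>
    rcases hx with rfl | rfl | rfl | rfl | rfl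
    · simpa using s1_zpow_mul_mem_cell ih 1
    · simpa using s2_zpow_mul_mem_cell ih 1
    · rw [e3, mul_assoc, mul_assoc]
      simpa using s5_zpow_mul_mem_cell (R.z_inv_mul_mem_cell (s1_zpow_mul_mem_cell ih 1)) 1
    · simpa using s4_zpow_mul_mem_cell ih 1
    · simpa using s5_zpow_mul_mem_cell ih 1
  | inv_mul_cancel x hx y _ ih =>
    rcases hx with rfl | rfl | rfl | rfl | rfl
    · simpa using s1_zpow_mul_mem_cell ih (-1)
    · simpa using s2_zpow_mul_mem_cell ih (-1)
    · rw [e3, _root_.mul_inv_rev, _root_.mul_inv_rev, inv_inv, mul_assoc, mul_assoc]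
      simpa using s1_zpow_mul_mem_cell (R.z_mul_mem_cell (s5_zpow_mul_mem_cell ih (-1))) (-1)
    · simpa using s4_zpow_mul_mem_cell ih (-1)
    · simpa using s5_zpow_mul_mem_cell ih (-1)

theorem injective : Function.Injective R.φ := by
  rw [injective_iff_map_eq_one]
  intro g hg
  have h := R.inv_mul_mem_klingen G.one_mem_cell (R.mem_cell g) (by
    rw [act_one, act, hg]; simp)
  rw [inv_one, one_mul] at h
  exact R.eq_one_of_mem_klingen h hg

/-- A symplectic matrix that fixes the first basis vector comes from the Klingen parabolic
subgroup. -/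
theorem exists_map_eq_of_mulVec_eq (M : symplecticGroup (Fin 2) ℤ)
    (h : (M : Matrix (Fin 2 ⊕ Fin 2) (Fin 2 ⊕ Fin 2) ℤ) *ᵥ e4 = e4) : ∃ g, R.φ g = M := by
  obtain ⟨M, hM⟩ := M
  simp only at h
  rw [← fromBlocks_toBlocks M] at h hM
  obtain ⟨A, hA⟩ : ∃ A, A = M.toBlocks₁₁ := ⟨_, rfl⟩
  obtain ⟨B, hB⟩ : ∃ B, B = M.toBlocks₁₂ := ⟨_, rfl⟩
  obtain ⟨C, hC⟩ : ∃ C, C = M.toBlocks₂₁ := ⟨_, rfl⟩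
  obtain ⟨D, hD⟩ : ∃ D, D = M.toBlocks₂₂ := ⟨_, rfl⟩
  rw [← hA, ← hB, ← hC, ← hD] at h hM
  rw [e4, fromBlocks_mulVec_vec4, vec4_inj] at h
  simp only [mul_one, mul_zero, add_zero] at h
  obtain ⟨a00, a10, c00, c10⟩ := h
  obtain ⟨h1, h2, h3⟩ := SymplecticGroup.fromBlocks_mem_iff.1 hM
  have h101 := congrFun (congrFun h1 0) 1
  have h201 := congrFun (congrFun h2 0) 1
  have h300 := congrFun (congrFun h3 0) 0
  have h301 := congrFun (congrFun h3 0) 1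
  have h310 := congrFun (congrFun h3 1) 0
  have h311 := congrFun (congrFun h3 1) 1
  simp [Matrix.mul_apply, Fin.sum_univ_two, a00, a10, c00, c10] at h101 h201 h300 h301 h310 h311
  rw [h300] at h201 h310
  rw [h301] at h201 h311
  -- The symplectic equations determine the two entries of the third column that the factorisation
  -- below does not prescribe.
  have k1 : B 1 0 - A 1 1 * B 0 1 + A 0 1 * B 1 1 = 0 := by
    linear_combination -B 1 0 * h311 + A 1 1 * h201 + B 1 1 * h310 +
      (B 1 1 * B 0 0 - B 1 0 * B 0 1) * h101
  have k2 : D 1 0 - C 1 1 * B 0 1 + A 0 1 * D 1 1 = 0 := by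
    linear_combination -D 1 0 * h311 + D 1 1 * h310 + C 1 1 * h201 +
      (D 1 1 * B 0 0 - D 1 0 * B 0 1) * h101
  let E : SpecialLinearGroup (Fin 2) ℤ := ⟨!![A 1 1, B 1 1; C 1 1, D 1 1], by
    rw [det_fin_two_of]; linear_combination h311 + B 0 1 * h101⟩
  -- The first row of the product is `(1, a, c + a * b, b)` for exponents `a`, `b`, `c` of `y`, `z`,
  -- `s1`, whence the correction by `A 0 1 * B 0 1`.
  refine ⟨G.psi2 E * (G.y ^ A 0 1 * G.z ^ B 0 1 * G.s1 ^ (B 0 0 - A 0 1 * B 0 1)), ?_⟩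
  apply Subtype.ext
  refine Matrix.ext_of_mulVec_single fun i => ?_
  have key : ∀ v, R.act (G.psi2 E * (G.y ^ A 0 1 * G.z ^ B 0 1 *
      G.s1 ^ (B 0 0 - A 0 1 * B 0 1))) v = M *ᵥ v := by
    intro v
    rw [← fromBlocks_toBlocks M, ← hA, ← hB, ← hC, ← hD, vec4_eta v, act_mul, act_heisenberg,
      act_psi2, fromBlocks_mulVec_vec4, vec4_inj]
    simp [E, a00, a10, c00, c10]
    rw [h101, h300, h301]
    refine ⟨by ring, ?_, by ring, ?_⟩
    · linear_combination -v (.inr 0) * k1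
    · linear_combination -v (.inr 0) * k2
  exact key _

theorem surjective : Function.Surjective R.φ := by
  intro M
  set v := (M : Matrix (Fin 2 ⊕ Fin 2) (Fin 2 ⊕ Fin 2) ℤ) *ᵥ e4 with hv
  have hM : ((M⁻¹ : symplecticGroup (Fin 2) ℤ) : Matrix (Fin 2 ⊕ Fin 2) (Fin 2 ⊕ Fin 2) ℤ) *ᵥ
      v = e4 := by
    rw [hv, mulVec_mulVec, ← Submonoid.coe_mul, inv_mul_cancel]; simp
  rw [vec4_eta v] at hM
  obtain ⟨a', b', c', d', hu⟩ := unimodular_of_mulVec_eq hM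
  obtain ⟨g, -, hg⟩ := R.exists_mem_cell_act_eq hu
  rw [← vec4_eta] at hg
  obtain ⟨k, hk⟩ := R.exists_map_eq_of_mulVec_eq ((R.φ g)⁻¹ * M) (by
    rw [Submonoid.coe_mul, ← mulVec_mulVec, ← hv, ← map_inv]
    exact R.act_inv_eq hg)
  exact ⟨g * k, by rw [map_mul, hk, mul_inv_cancel_left]⟩

end Sp4Rep

end SpecialLinear

/-! ### The relations for the matrices, and the presented group -/

open Matrix in
/-- The upper unipotent symplectic matrix attached to a symmetric matrix. -/
def upperSymplectic (B : Matrix (Fin 2) (Fin 2) ℤ) (hB : Bᵀ = B) : symplecticGroup (Fin 2) ℤ :=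
  ⟨fromBlocks 1 B 0 1, SymplecticGroup.fromBlocks_mem_iff.2 (by simp [hB])⟩

open Matrix in
/-- The lower unipotent symplectic matrix attached to a symmetric matrix. -/
def lowerSymplectic (C : Matrix (Fin 2) (Fin 2) ℤ) (hC : Cᵀ = C) : symplecticGroup (Fin 2) ℤ :=
  ⟨fromBlocks 1 0 C 1, SymplecticGroup.fromBlocks_mem_iff.2 (by simp [hC])⟩

/-- The matrices assigned to the five generators. -/
def sp4Generator : Fin 5 → Matrix.symplecticGroup (Fin 2) ℤ :=
  ![upperSymplectic !![1, 0; 0, 0] (by decide), lowerSymplectic !![-1, 0; 0, 0] (by decide),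
    upperSymplectic !![1, -1; -1, 1] (by decide), lowerSymplectic !![0, 0; 0, -1] (by decide),
    upperSymplectic !![0, 0; 0, 1] (by decide)]

theorem sp4Generator_inv_two :
    (sp4Generator 2)⁻¹ = upperSymplectic !![-1, 1; 1, -1] (by decide) := by
  rw [inv_eq_iff_mul_eq_one]
  apply Subtype.ext
  decide +kernel

theorem sp4Generator_relation {p : FreeGroup (Fin 5) × FreeGroup (Fin 5)}
    (hp : p ∈ sp4Relations) :
    FreeGroup.lift sp4Generator p.1 = FreeGroup.lift sp4Generator p.2 := by
  simp only [sp4Relations, List.mem_cons, List.not_mem_nil, or_false] at hp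
  -- With the inverses replaced by explicit matrices, each relation is an equality of integer matrix
  -- products that can be decided.
  have hz : sp4Generator 0 * (sp4Generator 2)⁻¹ * sp4Generator 4 =
      upperSymplectic !![0, 1; 1, 0] (by decide) := by
    rw [sp4Generator_inv_two]
    apply Subtype.ext
    decide +kernel
  have hz' : (upperSymplectic !![0, 1; 1, 0] (by decide))⁻¹ =
      upperSymplectic !![0, -1; -1, 0] (by decide) := by
    rw [inv_eq_iff_mul_eq_one]
    apply Subtype.ext
    decide +kernel
  rcases hp with rfl | rfl | rfl | rfl | rfl | rfl | rfl | rfl | rfl | rfl | rfl | rfl <;>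
    simp only [sigma1, sigma2, sigma3, sigma4, sigma5, map_mul, map_pow, map_inv, map_one,
      FreeGroup.lift_apply_of, hz, hz', mul_inv_eq_iff_eq_mul] <;>
    apply Subtype.ext <;> decide +kernel

theorem presentedGroup_mul_eq {p : FreeGroup (Fin 5) × FreeGroup (Fin 5)}
    (hp : p ∈ sp4Relations) :
    PresentedGroup.mk sp4Relators p.1 = PresentedGroup.mk sp4Relators p.2 := by
  rw [← mul_inv_eq_one, ← map_inv, ← map_mul]
  exact PresentedGroup.one_of_mem ⟨p, hp, rfl⟩

/-- The generators of the presented group. -/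
def sp4PresentedSystem : Sp4System (PresentedGroup sp4Relators) where
  s1 := PresentedGroup.of 0
  s2 := PresentedGroup.of 1
  s3 := PresentedGroup.of 2
  s4 := PresentedGroup.of 3
  s5 := PresentedGroup.of 4
  c13 := presentedGroup_mul_eq (p := (sigma1 * sigma3, sigma3 * sigma1)) (by simp [sp4Relations])
  c14 := presentedGroup_mul_eq (p := (sigma1 * sigma4, sigma4 * sigma1)) (by simp [sp4Relations])
  c15 := presentedGroup_mul_eq (p := (sigma1 * sigma5, sigma5 * sigma1)) (by simp [sp4Relations])
  c24 := presentedGroup_mul_eq (p := (sigma2 * sigma4, sigma4 * sigma2)) (by simp [sp4Relations])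
  c25 := presentedGroup_mul_eq (p := (sigma2 * sigma5, sigma5 * sigma2)) (by simp [sp4Relations])
  c35 := presentedGroup_mul_eq (p := (sigma3 * sigma5, sigma5 * sigma3)) (by simp [sp4Relations])
  b12 := presentedGroup_mul_eq (p := (sigma1 * sigma2 * sigma1, sigma2 * sigma1 * sigma2))
    (by simp [sp4Relations])
  b23 := presentedGroup_mul_eq (p := (sigma2 * sigma3 * sigma2, sigma3 * sigma2 * sigma3))
    (by simp [sp4Relations])
  b34 := presentedGroup_mul_eq (p := (sigma3 * sigma4 * sigma3, sigma4 * sigma3 * sigma4))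
    (by simp [sp4Relations])
  b45 := presentedGroup_mul_eq (p := (sigma4 * sigma5 * sigma4, sigma5 * sigma4 * sigma5))
    (by simp [sp4Relations])
  inv_z := presentedGroup_mul_eq (p := ((sigma1 * sigma2 * sigma1) ^ 2 *
    (sigma1 * sigma3⁻¹ * sigma5) * ((sigma1 * sigma2 * sigma1) ^ 2)⁻¹,
    (sigma1 * sigma3⁻¹ * sigma5)⁻¹)) (by simp [sp4Relations])
  pow_four := presentedGroup_mul_eq (p := ((sigma1 * sigma2 * sigma1) ^ 4, 1))
    (by simp [sp4Relations])

theorem sp4Generator_relator : ∀ r ∈ sp4Relators, FreeGroup.lift sp4Generator r = 1 := by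
  rintro _ ⟨p, hp, rfl⟩
  rw [map_mul, map_inv, mul_inv_eq_one]
  exact sp4Generator_relation hp

/-- The homomorphism from the presented group to the symplectic group. -/
def sp4PresentedRep : Sp4Rep sp4PresentedSystem where
  φ := PresentedGroup.toGroup sp4Generator_relator
  map_s1 := congrArg Subtype.val (PresentedGroup.toGroup.of sp4Generator_relator)
  map_s2 := congrArg Subtype.val (PresentedGroup.toGroup.of sp4Generator_relator)
  map_s3 := congrArg Subtype.val (PresentedGroup.toGroup.of sp4Generator_relator)
  map_s4 := congrArg Subtype.val (PresentedGroup.toGroup.of sp4Generator_relator)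
  map_s5 := congrArg Subtype.val (PresentedGroup.toGroup.of sp4Generator_relator)
  closure_eq_top := by
    rw [eq_top_iff, ← PresentedGroup.closure_range_of sp4Relators, Subgroup.closure_le]
    rintro _ ⟨i, rfl⟩
    apply Subgroup.subset_closure
    fin_cases i <;> simp [sp4PresentedSystem]

/-- The group `Sp₄(ℤ)` is presented by five generators and the twelve relations above, where the
generators correspond to the displayed symplectic matrices (in `2 × 2` blocks). -/
theorem corollary2 :
    ∃ e : PresentedGroup sp4Relators ≃* Matrix.symplecticGroup (Fin 2) ℤ,
      (e (PresentedGroup.of 0) : Matrix (Fin 2 ⊕ Fin 2) (Fin 2 ⊕ Fin 2) ℤ) =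
          Matrix.fromBlocks 1 !![1, 0; 0, 0] 0 1 ∧
      (e (PresentedGroup.of 1) : Matrix (Fin 2 ⊕ Fin 2) (Fin 2 ⊕ Fin 2) ℤ) =
          Matrix.fromBlocks 1 0 !![-1, 0; 0, 0] 1 ∧
      (e (PresentedGroup.of 2) : Matrix (Fin 2 ⊕ Fin 2) (Fin 2 ⊕ Fin 2) ℤ) =
          Matrix.fromBlocks 1 !![1, -1; -1, 1] 0 1 ∧
      (e (PresentedGroup.of 3) : Matrix (Fin 2 ⊕ Fin 2) (Fin 2 ⊕ Fin 2) ℤ) =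
          Matrix.fromBlocks 1 0 !![0, 0; 0, -1] 1 ∧
      (e (PresentedGroup.of 4) : Matrix (Fin 2 ⊕ Fin 2) (Fin 2 ⊕ Fin 2) ℤ) =
          Matrix.fromBlocks 1 !![0, 0; 0, 1] 0 1 :=
  ⟨MulEquiv.ofBijective sp4PresentedRep.φ ⟨sp4PresentedRep.injective, sp4PresentedRep.surjective⟩,
    sp4PresentedRep.map_s1, sp4PresentedRep.map_s2, sp4PresentedRep.map_s3,
    sp4PresentedRep.map_s4, sp4PresentedRep.map_s5⟩
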